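/- **Setting.** Let $\Theta\subset\mathbb R^d$ be compact, $d\ge 1$, let $x=(x_1,\dots,x_n)\in\mathcal X^n$ with $n\ge 2$, let $\ell(\cdot,x_i)$ be losses, differentiable on $\Theta$, and let $f(\theta)=\frac1n\sum_{i=1}^n\ell(\theta,x_i)$. Assume, for constants $L,\tau,r,B>0$ and $C_{\mathcal X}\ge0$: 1. $\|\nabla f(\theta)-\nabla f(\theta')\|\le L\|\theta-\theta'\|$ for all $\theta,\theta'\in\Theta$. 2. $f$ has a local minimum $\theta^*$ on $\Theta$ with $\|\theta^{(0)}-\theta^*\|\le r$, the closed ball $\bar B_r(\theta^*)$ is contained in $\Theta$, and $\langle\nabla f(\theta)-\nabla f(\theta'),\theta-\theta'\rangle\ge\tau\|\theta-\theta'\|^2$ for all $\theta,\theta'\in\bar B_r(\theta^*)$. 3. $\|\nabla\ell(\theta,x_i)\|\le B$ for all $i$ and all $\theta\in\Theta$. 4. The kernel $k$ is stationary, $k(u,v)=\phi(u-v)$ with $\phi\in C^4(\mathbb R^d)$, and positive definite: $k(\mathcal D,\mathcal D)=(k(p,q))_{p,q\in\mathcal D}$ is a positive definite matrix for every finite $\mathcal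 D\subset\Theta$. 5. Each $\ell(\cdot,x_i)$, restricted to $\Theta$, lies in the reproducing kernel Hilbert space $\mathcal H$ of $k$ on $\Theta$, with $\|\ell(\cdot,x_i)\|_{\mathcal H}\le C_{\mathcal X}$. For a finite $\mathcal D\subset\Theta$ put $k_{\mathcal D}(u,v)=k(u,v)-k(u,\mathcal D)k(\mathcal D,\mathcal D)^{-1}k(\mathcal D,v)$ and $$\rho_{\mathcal D}(\theta)=\operatorname{Tr}\big(\nabla k_{\mathcal D}(\theta,\theta)\nabla^\top\big)=\sum_{i=1}^d\partial_{u_i}\partial_{v_i}k_{\mathcal D}(u,v)\big|_{u=v=\theta}.$$ **Algorithm** (noiseless evaluations; inputs: tolerance $\varepsilon>0$, step size $0<\eta\le 1/L$, privacy level $\mu>0$, number of iterations $T$). Start at $\theta^{(0)}$ with $\mathcal D_{-1}=\emptyset$. For $t=0,\dots,T-1$: let $b_t\ge1$ be the least $b$ for which some $z\subset\Theta$ with $|z|=b$ satisfies $\rho_{\mathcal D_{t-1}\cup z}(\theta^{(t)})\le\varepsilon$; choose, by any fixed rule depending on $(\mathcal D_{t-1},\theta^{(t)})$, such a batch $z_t$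 with $|z_t|=b_t$ (for instance a minimizer of $\rho_{\mathcal D_{t-1}\cup z}(\theta^{(t)})$ over $|z|=b_t$, if there is one); evaluate the losses at the $b_t$ points of $z_t$ and put $\mathcal D_t=\mathcal D_{t-1}\cup z_t$; then set $$g_t^{(i)}=\nabla k(\theta^{(t)},\mathcal D_t)\,k(\mathcal D_t,\mathcal D_t)^{-1}\,\ell(\mathcal D_t,x_i),\qquad g_t=\frac1n\sum_{i=1}^n g_t^{(i)}\min\Big\{1,\frac{B}{\|g_t^{(i)}\|}\Big\},$$ $$\theta^{(t+1)}=\theta^{(t)}-\eta\Big(g_t+\frac{2B\sqrt T}{n\mu}w_t\Big),\qquad w_0,\dots,w_{T-1}\ \text{i.i.d. } N(0,I_d).$$ **Lemma.** For all $L,\tau,r,B>0$, $0<\eta\le1/L$ and $\bar\mu>0$ there are constants $K,C_0,C>0$, depending only on $L,\tau,r,B,\eta,\bar\mu$, such that the following holds for all $d\ge1$, $n\ge2$, $\delta\in(0,1)$, $\mu\in(0,\bar\mu]$ and $C_{\mathcal X}\ge0$. Put $T=\lceil K\log n\rceil$ and suppose that $$n\ \ge\ C_0\,\frac{\sqrt{T\,(d+\log\frac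 T\delta)}}{\mu}.$$ Then there is $\varepsilon_0>0$ with $4C_{\mathcal X}^2\,\varepsilon_0\le\tau^2r^2$, depending only on the quantities named so far, such that for every $\varepsilon\in(0,\varepsilon_0]$ and in every setting as above satisfying 1–5, the algorithm run for $T$ iterations has, with probability at least $1-\delta$, the following properties: all iterates $\theta^{(0)},\dots,\theta^{(T)}$ lie in $\Theta$ and the choice of $b_t$ is possible in each iteration, the total number of function evaluations satisfies $$\sum_{t=0}^{T-1}b_t\ \le\ C\,d\log n,$$ and $$F_T=f(\theta^{(T)})-f(\theta^*)\ \le\ C\,\frac{\sqrt{\log n\,\big(d+\log\frac{\log n}{\delta}\big)}}{n\mu}.$$ -/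

import Mathlib

open Set Filter Topology MeasureTheory ProbabilityTheory Finset BigOperators Matrix

noncomputable section

namespace DPGIBO

/-- The ambient space `ℝ^d` of the parameters, with the Euclidean norm. -/
abbrev Param (d : ℕ) := EuclideanSpace ℝ (Fin d)

variable {d : ℕ}

/-! ### Kernel interpolation with exact (noiseless) observations -/

/-- The Gram matrix `k(D, D)` of a kernel at a finite set `D` of points. -/
def gram (k : Param d → Param d → ℝ) (D : Finset (Param d)) : Matrix D D ℝ :=
  Matrix.of fun p q => k p q

open scoped Classical in
/-- The posterior kernel `k_D(u, v) = k(u, v) - k(u, D) k(D, D)⁻¹ k(D, v)`. -/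
def postKernel (k : Param d → Param d → ℝ) (D : Finset (Param d)) (u v : Param d) : ℝ :=
  k u v - (fun p : D => k u p) ⬝ᵥ ((gram k D)⁻¹ *ᵥ (fun p : D => k p v))

/-- `Tr(∇ k_D(θ, θ) ∇ᵀ) = ∑ i, ∂_{u_i} ∂_{v_i} k_D(u, v)` at `u = v = θ`: the trace of the posterior
covariance of the gradient at `θ`, given exact evaluations at the points of `D`. -/
def gradCovTrace (k : Param d → Param d → ℝ) (D : Finset (Param d)) (θ : Param d) : ℝ :=
  ∑ i : Fin d,
    lineDeriv ℝ
      (fun u => lineDeriv ℝ (fun v => postKernel k D u v) θ (EuclideanSpace.single i (1 : ℝ)))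
      θ (EuclideanSpace.single i (1 : ℝ))

open scoped Classical in
/-- The gradient at `θ` of the posterior mean, `∇ k(θ, D) k(D, D)⁻¹ y`, where `y` collects the
exact evaluations of the function `g` at the points of `D`. -/
def postGrad (k : Param d → Param d → ℝ) (D : Finset (Param d)) (g : Param d → ℝ)
    (θ : Param d) : Param d :=
  ∑ p : D, ((gram k D)⁻¹ *ᵥ (fun q : D => g q)) p • gradient (fun u => k u p) θ

/-! ### The algorithm -/

/-- The average loss `f_x(θ) = (1/n) ∑ i, ℓ(θ, x_i)`. -/
def avgLoss {𝒳 : Type*} {n : ℕ} (ℓ : Param d → 𝒳 → ℝ) (x : Fin n → 𝒳) (θ : Param d) : ℝ :=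
  (1 / (n : ℝ)) * ∑ i, ℓ θ (x i)

/-- Clipping: `g * min {1, B / ‖g‖}`. -/
def clip (B : ℝ) (g : Param d) : Param d := min 1 (B / ‖g‖) • g

/-- The clipped and averaged approximate gradient `g_t` computed from the evaluation set `D`. -/
def approxGrad {𝒳 : Type*} {n : ℕ} (k : Param d → Param d → ℝ) (ℓ : Param d → 𝒳 → ℝ)
    (x : Fin n → 𝒳) (B : ℝ) (D : Finset (Param d)) (θ : Param d) : Param d :=
  (1 / (n : ℝ)) • ∑ i, clip B (postGrad k D (fun u => ℓ u (x i)) θ)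

open scoped Classical in
/-- `z` is a nonempty batch of query points in `Θ` which, added to the points `D` evaluated so far,
makes the gradient uncertainty at `θ` at most `ε`. -/
def IsAdmissibleBatch (k : Param d → Param d → ℝ) (Θ : Set (Param d)) (ε : ℝ)
    (D : Finset (Param d)) (θ : Param d) (z : Finset (Param d)) : Prop :=
  (z : Set (Param d)) ⊆ Θ ∧ 1 ≤ z.card ∧ gradCovTrace k (D ∪ z) θ ≤ ε

/-- A rule for choosing the batch from the past evaluation set `D` and the current iterate `θ`.
Whenever some batch is admissible, the rule returns an admissible batch of least cardinality `b`.
A minimizer of the gradient uncertainty over all batches of that cardinality is such a batch; the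
minimum need not be attained, and nothing more than admissibility is asked of the batch. -/
def IsBatchRule (k : Param d → Param d → ℝ) (Θ : Set (Param d)) (ε : ℝ)
    (sel : Finset (Param d) → Param d → Finset (Param d)) : Prop :=
  ∀ (D : Finset (Param d)) (θ : Param d), (D : Set (Param d)) ⊆ Θ → θ ∈ Θ →
    (∃ z, IsAdmissibleBatch k Θ ε D θ z) →
      IsAdmissibleBatch k Θ ε D θ (sel D θ) ∧
        ∀ z, IsAdmissibleBatch k Θ ε D θ z → (sel D θ).card ≤ z.card

open scoped Classical in
/-- The state `(D_{t-1}, θ^(t))` of the algorithm before iteration `t`, with `D_{-1} = ∅`, as a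
function of the Gaussian vectors `w 0, w 1, …`. The algorithm is meant to make `T` iterations, to
which its noise level `2 B √T / (n μ)` is tuned. -/
def state {𝒳 : Type*} {n : ℕ} (k : Param d → Param d → ℝ) (ℓ : Param d → 𝒳 → ℝ)
    (x : Fin n → 𝒳) (sel : Finset (Param d) → Param d → Finset (Param d))
    (B η μ : ℝ) (T : ℕ) (θ₀ : Param d) (w : ℕ → Param d) :
    ℕ → Finset (Param d) × Param d
  | 0 => (∅, θ₀)
  | t + 1 =>
    let s := state k ℓ x sel B η μ T θ₀ w t
    let D := s.1 ∪ sel s.1 s.2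
    (D, s.2 - η • (approxGrad k ℓ x B D s.2 + (2 * B * √(T : ℝ) / (n * μ)) • w t))

/-- The number of function evaluations made in the first `T` iterations: the batch queried in
iteration `t` is `sel D_{t-1} θ^(t)`. -/
def numEvals (sel : Finset (Param d) → Param d → Finset (Param d))
    (s : ℕ → Finset (Param d) × Param d) (T : ℕ) : ℕ :=
  ∑ t ∈ Finset.range T, (sel (s t).1 (s t).2).card

/-! ### The assumptions -/

/-- `f` is `L`-smooth on `Θ`. -/
def IsSmoothOn (L : ℝ) (Θ : Set (Param d)) (f : Param d → ℝ) : Prop :=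
  ∀ θ ∈ Θ, ∀ θ' ∈ Θ, ‖gradient f θ - gradient f θ'‖ ≤ L * ‖θ - θ'‖

/-- `f` has the local minimum `θs` on `Θ`, the initial point `θ₀` is within `r` of it, and `f` is
`τ`-strongly convex in the ball of radius `r` around `θs`, which lies in the domain `Θ` of `f`. -/
structure IsLocallyStronglyConvex (τ r : ℝ) (Θ : Set (Param d)) (f : Param d → ℝ)
    (θ₀ θs : Param d) : Prop where
  isLocalMinOn : IsLocalMinOn f Θ θs
  init_close : ‖θ₀ - θs‖ ≤ r
  ball_subset : Metric.closedBall θs r ⊆ Θ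
  strong : ∀ θ ∈ Metric.closedBall θs r, ∀ θ' ∈ Metric.closedBall θs r,
    τ * ‖θ - θ'‖ ^ 2 ≤ inner ℝ (gradient f θ - gradient f θ') (θ - θ')

/-- The individual losses are differentiable on `Θ`, with gradients bounded by `B`. -/
def HasBoundedGradients {𝒳 : Type*} {n : ℕ} (B : ℝ) (Θ : Set (Param d))
    (ℓ : Param d → 𝒳 → ℝ) (x : Fin n → 𝒳) : Prop :=
  ∀ i, ∀ θ ∈ Θ, DifferentiableAt ℝ (fun u => ℓ u (x i)) θ ∧
    ‖gradient (fun u => ℓ u (x i)) θ‖ ≤ B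

/-- The kernel is stationary, four times continuously differentiable, and positive definite
on `Θ`. -/
structure IsAdmissibleKernel (Θ : Set (Param d)) (k : Param d → Param d → ℝ) : Prop where
  stationary : ∃ φ : Param d → ℝ, ContDiff ℝ 4 φ ∧ ∀ u v, k u v = φ (u - v)
  posDef : ∀ D : Finset (Param d), (D : Set (Param d)) ⊆ Θ → (gram k D).PosDef

/-- `H` is the reproducing kernel Hilbert space on `Θ` whose kernel is the restriction of `k`. -/
def IsRKHSOf (Θ : Set (Param d)) (k : Param d → Param d → ℝ) (H : Type*)
    [NormedAddCommGroup H] [InnerProductSpace ℝ H] [CompleteSpace H] [RKHS ℝ H Θ ℝ] : Prop :=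
  ∀ p q : Θ, RKHS.kernel H p q 1 = k p q

/-- Every individual loss, restricted to `Θ`, is an element of `H` of norm at most `CX`. -/
def HasBoundedRKHSNorm {𝒳 : Type*} {n : ℕ} (CX : ℝ) (Θ : Set (Param d))
    (ℓ : Param d → 𝒳 → ℝ) (x : Fin n → 𝒳) (H : Type*)
    [NormedAddCommGroup H] [InnerProductSpace ℝ H] [RKHS ℝ H Θ ℝ] : Prop :=
  ∀ i, ∃ h : H, (∀ p : Θ, h p = ℓ p (x i)) ∧ ‖h‖ ≤ CX

end DPGIBO

end

namespace DPGIBO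

/-! ### A gradient step contracts the distance to a minimizer -/

/-! Outside an event of probability at most `δ` the run is a perturbed gradient descent that never
leaves the ball of strong convexity.

Let `Φ` be the feature map of the RKHS. Since the kernel is `C²` and stationary, difference
quotients of `Φ` converge to vectors `g j` that represent the partial derivatives at `θ`. Posterior
quantities then become Hilbert space geometry: `gradCovTrace` is the sum of the squared distances
from `g j` to the span of the features of the evaluated points (`exists_gradient_features`). Hence
`2 d` points, two for each coordinate difference quotient, reach any tolerance
(`exists_isAdmissibleBatch`). By Cauchy–Schwarz the gradient error is at most `CX * √ε`, and
clipping at most doubles it (`norm_approxGrad_sub_gradient_le`).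

An exact step contracts the distance to the minimizer by a factor `q < 1`
(`norm_gradient_step_sub_sq_le`). With total perturbation at most `a ≤ (1 - q) * r` per step, the
recursion `q * dist + a` keeps the iterates in the ball and ends below `q ^ T * r + a / (1 - q)`
(`iterates_of_noise_le`). A Gaussian tail and a union bound control all noise vectors. Taking `T` of
order `log n` makes `q ^ T ≤ 1 / n`, and the gradient bound `B` turns distance into excess loss. -/

theorem le_of_deriv_le_affine {ψ ψ' : ℝ → ℝ} {A : ℝ}
    (h : ∀ s ∈ Set.Icc (0 : ℝ) 1, HasDerivAt ψ (ψ' s) s)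
    (hA : ∀ s ∈ Set.Ioo (0 : ℝ) 1, ψ' s ≤ ψ' 0 + s * A) :
    ψ 1 ≤ ψ 0 + ψ' 0 + A / 2 := by
  have hd : ∀ s ∈ Set.Icc (0 : ℝ) 1,
      HasDerivAt (fun s => ψ s - s * ψ' 0 - s ^ 2 * (A / 2)) (ψ' s - ψ' 0 - s * A) s := by
    intro s hs
    have h1 := ((h s hs).sub ((hasDerivAt_id s).mul_const (ψ' 0))).sub
      (((hasDerivAt_id s).pow 2).mul_const (A / 2))
    refine HasDerivAt.congr_deriv h1 ?_
    simp only [id, pow_one, Nat.add_one_sub_one, Nat.cast_ofNat]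
    ring
  -- Monotonicity replaces integration of `ψ'`, so no continuity of the derivative is needed.
  have hanti : AntitoneOn (fun s => ψ s - s * ψ' 0 - s ^ 2 * (A / 2)) (Set.Icc 0 1) := by
    apply antitoneOn_of_deriv_nonpos (convex_Icc 0 1)
    · exact fun s hs => (hd s hs).continuousAt.continuousWithinAt
    · intro s hs
      rw [interior_Icc] at hs
      exact (hd s (Set.Ioo_subset_Icc_self hs)).differentiableAt.differentiableWithinAt
    · intro s hs
      rw [interior_Icc] at hs
      rw [(hd s (Set.Ioo_subset_Icc_self hs)).deriv]
      linarith [hA s hs]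
  have := hanti (Set.left_mem_Icc.2 zero_le_one) (Set.right_mem_Icc.2 zero_le_one) zero_le_one
  simp only at this
  linarith

variable {E : Type*} [NormedAddCommGroup E] [InnerProductSpace ℝ E] [CompleteSpace E]

theorem hasDerivAt_comp_segment {f : E → ℝ} {x y : E} {s : ℝ}
    (h : DifferentiableAt ℝ f (x + s • (y - x))) :
    HasDerivAt (fun s : ℝ => f (x + s • (y - x)))
      (inner ℝ (gradient f (x + s • (y - x))) (y - x)) s := by
  have h1 : HasDerivAt (fun s : ℝ => x + s • (y - x)) (y - x) s := by
    simpa using ((hasDerivAt_id s).smul_const (y - x)).const_add x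
  have h2 := h.hasGradientAt.hasFDerivAt.comp_hasDerivAt s h1
  exact HasDerivAt.congr_deriv h2 (by simp)

theorem le_quadratic_of_lipschitz_gradient {f : E → ℝ} {S : Set E} {L : ℝ} (hS : Convex ℝ S)
    (hd : ∀ x ∈ S, DifferentiableAt ℝ f x)
    (hL : ∀ x ∈ S, ∀ y ∈ S, ‖gradient f x - gradient f y‖ ≤ L * ‖x - y‖)
    {x y : E} (hx : x ∈ S) (hy : y ∈ S) :
    f y ≤ f x + inner ℝ (gradient f x) (y - x) + L / 2 * ‖y - x‖ ^ 2 := by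
  have hmem : ∀ s ∈ Set.Icc (0 : ℝ) 1, x + s • (y - x) ∈ S := fun s hs =>
    hS.add_smul_sub_mem hx hy hs
  have := le_of_deriv_le_affine (A := L * ‖y - x‖ ^ 2)
    (fun s hs => hasDerivAt_comp_segment (hd _ (hmem s hs))) (fun s hs => by
      have h1 := hL _ (hmem s (Set.Ioo_subset_Icc_self hs)) x hx
      have h2 := real_inner_le_norm (gradient f (x + s • (y - x)) - gradient f x) (y - x)
      rw [inner_sub_left] at h2
      rw [add_sub_cancel_left, norm_smul, Real.norm_of_nonneg hs.1.le] at h1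
      have h3 := mul_le_mul_of_nonneg_right h1 (norm_nonneg (y - x))
      simp only [zero_smul, add_zero]
      nlinarith)
  simp only [zero_smul, add_zero, one_smul, add_sub_cancel] at this
  linarith

theorem quadratic_le_of_strongly_monotone_gradient {f : E → ℝ} {S : Set E} {τ : ℝ}
    (hS : Convex ℝ S) (hd : ∀ x ∈ S, DifferentiableAt ℝ f x)
    (hτ : ∀ x ∈ S, ∀ y ∈ S,
      τ * ‖x - y‖ ^ 2 ≤ inner ℝ (gradient f x - gradient f y) (x - y))
    {x y : E} (hx : x ∈ S) (hy : y ∈ S) :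
    f x + inner ℝ (gradient f x) (y - x) + τ / 2 * ‖y - x‖ ^ 2 ≤ f y := by
  have hmem : ∀ s ∈ Set.Icc (0 : ℝ) 1, x + s • (y - x) ∈ S := fun s hs =>
    hS.add_smul_sub_mem hx hy hs
  have := le_of_deriv_le_affine (A := - (τ * ‖y - x‖ ^ 2))
    (fun s hs => (hasDerivAt_comp_segment (hd _ (hmem s hs))).neg) (fun s hs => by
      have h1 := hτ _ (hmem s (Set.Ioo_subset_Icc_self hs)) x hx
      rw [add_sub_cancel_left, norm_smul, Real.norm_of_nonneg hs.1.le, inner_smul_right,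
        inner_sub_left, mul_pow] at h1
      have h3 : s * (s * (τ * ‖y - x‖ ^ 2)) ≤
          s * (inner ℝ (gradient f (x + s • (y - x))) (y - x) -
            inner ℝ (gradient f x) (y - x)) := by linarith
      have h4 := le_of_mul_le_mul_left h3 hs.1
      simp only [zero_smul, add_zero]
      linarith)
  simp only [zero_smul, add_zero, one_smul, add_sub_cancel, Pi.neg_apply] at this
  linarith

/-- Smoothness and convexity are known only inside the ball, so the usual argument needs the end of
the step to lie there. That is not assumed but proved: if the full step left the ball, a shorter
step would return exactly to the distance `‖x - c‖`, contradicting the strict contraction valid for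
steps that end inside. -/
theorem norm_gradient_step_sub_sq_le {f : E → ℝ} {c : E} {r L τ η : ℝ} (hL : 0 < L) (hτ : 0 < τ)
    (hη : 0 < η) (hηL : η ≤ 1 / L)
    (hd : ∀ x ∈ Metric.closedBall c r, DifferentiableAt ℝ f x)
    (hlip : ∀ x ∈ Metric.closedBall c r, ∀ y ∈ Metric.closedBall c r,
      ‖gradient f x - gradient f y‖ ≤ L * ‖x - y‖)
    (hmono : ∀ x ∈ Metric.closedBall c r, ∀ y ∈ Metric.closedBall c r,
      τ * ‖x - y‖ ^ 2 ≤ inner ℝ (gradient f x - gradient f y) (x - y))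
    (hc : gradient f c = 0) {x : E} (hx : x ∈ Metric.closedBall c r) :
    ‖x - η • gradient f x - c‖ ^ 2 ≤ (1 - η * τ) * ‖x - c‖ ^ 2 := by
  have hball : Convex ℝ (Metric.closedBall c r) := convex_closedBall c r
  have hxr : ‖x - c‖ ≤ r := by rwa [mem_closedBall_iff_norm] at hx
  have hr : 0 ≤ r := (norm_nonneg _).trans hxr
  have hcm : c ∈ Metric.closedBall c r := Metric.mem_closedBall_self hr
  set g := gradient f x with hg
  have hexp : ∀ s : ℝ, ‖x - s • g - c‖ ^ 2 =
      ‖x - c‖ ^ 2 - 2 * s * inner ℝ g (x - c) + s ^ 2 * ‖g‖ ^ 2 := by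
    intro s
    rw [show x - s • g - c = (x - c) - s • g by abel, norm_sub_sq_real, inner_smul_right,
      norm_smul, real_inner_comm, mul_pow, Real.norm_eq_abs, sq_abs]
    ring
  have hmin : f x + inner ℝ g (c - x) + τ / 2 * ‖x - c‖ ^ 2 ≤ f c := by
    have := quadratic_le_of_strongly_monotone_gradient hball hd hmono hx hcm
    rwa [norm_sub_rev] at this
  have hstep : ∀ s : ℝ, 0 ≤ s → s ≤ η → ‖x - s • g - c‖ ≤ r →
      ‖x - s • g - c‖ ^ 2 ≤ (1 - s * τ) * ‖x - c‖ ^ 2 := by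
    intro s hs0 hsη hsr
    have hsm : x - s • g ∈ Metric.closedBall c r := by rwa [mem_closedBall_iff_norm]
    have h1 := le_quadratic_of_lipschitz_gradient hball hd hlip hx hsm
    have h2 := quadratic_le_of_strongly_monotone_gradient hball hd hmono hcm hsm
    rw [hc, inner_zero_left] at h2
    have h3 : 0 ≤ τ / 2 * ‖x - s • g - c‖ ^ 2 := by positivity
    rw [show x - s • g - x = -(s • g) by abel, ← hg, inner_neg_right, inner_smul_right,
      real_inner_self_eq_norm_sq, norm_neg, norm_smul, mul_pow, Real.norm_eq_abs, sq_abs] at h1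
    have hsL : s * L ≤ 1 := by
      calc s * L ≤ 1 / L * L := by gcongr; exact hsη.trans hηL
        _ = 1 := by field_simp
    have h4 : L / 2 * (s ^ 2 * ‖g‖ ^ 2) ≤ s / 2 * ‖g‖ ^ 2 := by
      have : 0 ≤ s / 2 * ‖g‖ ^ 2 := by positivity
      nlinarith [mul_le_mul_of_nonneg_right hsL this]
    have h5 : inner ℝ g (c - x) = - inner ℝ g (x - c) := by
      rw [← inner_neg_right, neg_sub]
    -- The step decreases `f` by at least `s / 2 * ‖g‖ ^ 2` but not below `f c`, and strong
    -- convexity bounds `f x - f c` from above by the right side.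
    have h6 : s / 2 * ‖g‖ ^ 2 ≤ inner ℝ g (x - c) - τ / 2 * ‖x - c‖ ^ 2 := by
      linarith
    have h7 := mul_le_mul_of_nonneg_left h6 hs0
    rw [hexp]
    linarith
  by_cases hin : ‖x - η • g - c‖ ≤ r
  · exact hstep η hη.le le_rfl hin
  · exfalso
    have ha : τ * ‖x - c‖ ^ 2 ≤ inner ℝ g (x - c) := by
      have := hmono x hx c hcm
      rwa [hc, sub_zero] at this
    have hDr : ‖x - c‖ ^ 2 ≤ r ^ 2 := by gcongr
    have h1 : r ^ 2 < ‖x - η • g - c‖ ^ 2 := by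
      push Not at hin
      gcongr
    rw [hexp] at h1
    have hxc : 0 < ‖x - c‖ ^ 2 := by
      rcases eq_or_ne x c with h | h
      · have hg0 : g = 0 := by rw [hg, h, hc]
        exfalso
        apply hin
        rw [hg0, smul_zero, sub_zero]
        exact hxr
      · have := norm_pos_iff.2 (sub_ne_zero.2 h)
        positivity
    have ha0 : 0 < inner ℝ g (x - c) := lt_of_lt_of_le (by positivity) ha
    have h2 : 2 * inner ℝ g (x - c) < η * ‖g‖ ^ 2 := by
      have : 0 < η * (η * ‖g‖ ^ 2 - 2 * inner ℝ g (x - c)) := by nlinarith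
      linarith [(mul_pos_iff_of_pos_left hη).1 this]
    have hG : 0 < ‖g‖ ^ 2 := by
      by_contra h
      have : ‖g‖ ^ 2 = 0 := le_antisymm (not_lt.1 h) (by positivity)
      rw [this] at h2
      linarith
    -- The nonzero step length at which the quadratic `hexp` takes its initial value again; by `h2`
    -- it is below `η`.
    have hs0 : 0 < 2 * inner ℝ g (x - c) / ‖g‖ ^ 2 := by positivity
    have hse : ‖x - (2 * inner ℝ g (x - c) / ‖g‖ ^ 2) • g - c‖ ^ 2 = ‖x - c‖ ^ 2 := by
      rw [hexp]
      field_simp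
      ring
    have h3 := hstep _ hs0.le ((div_le_iff₀ hG).2 h2.le)
      (abs_le_of_sq_le_sq' (hse.le.trans hDr) hr).2
    rw [hse] at h3
    nlinarith [mul_pos (mul_pos hs0 hτ) hxc]

end DPGIBO

namespace DPGIBO

/-! ### The tail of the norm of a Gaussian vector -/

theorem integral_exp_sq_div_four_gaussianReal :
    Integrable (fun x : ℝ => Real.exp (x ^ 2 / 4)) (gaussianReal 0 1) ∧
      ∫ x, Real.exp (x ^ 2 / 4) ∂(gaussianReal 0 1) = √2 := by
  have hprod : ∀ x : ℝ, (gaussianPDF 0 1 x).toReal • Real.exp (x ^ 2 / 4) =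
      (√(2 * Real.pi))⁻¹ * Real.exp (-(1 / 4) * x ^ 2) := by
    intro x
    rw [toReal_gaussianPDF, gaussianPDFReal, smul_eq_mul, mul_assoc, ← Real.exp_add]
    simp only [NNReal.coe_one, mul_one, sub_zero]
    congr 2
    ring
  constructor
  · rw [gaussianReal_of_var_ne_zero 0 one_ne_zero,
      integrable_withDensity_iff_integrable_smul' (measurable_gaussianPDF 0 1)
        (ae_of_all _ fun x => gaussianPDF_lt_top)]
    simp_rw [hprod]
    exact (integrable_exp_neg_mul_sq (by norm_num)).const_mul _
  · rw [integral_gaussianReal_eq_integral_smul one_ne_zero]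
    simp_rw [← toReal_gaussianPDF, hprod]
    rw [integral_const_mul, integral_gaussian, ← Real.sqrt_inv, ← Real.sqrt_mul (by positivity)]
    congr 1
    field_simp
    norm_num

theorem integral_exp_norm_sq_div_four_stdGaussian (d : ℕ) :
    Integrable (fun x : EuclideanSpace ℝ (Fin d) => Real.exp (‖x‖ ^ 2 / 4)) (stdGaussian _) ∧
      ∫ x : EuclideanSpace ℝ (Fin d), Real.exp (‖x‖ ^ 2 / 4) ∂(stdGaussian _) = √2 ^ d := by
  have hm : AEMeasurable (WithLp.toLp 2)
      (Measure.pi fun _ : Fin d => gaussianReal 0 1) :=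
    Measurable.aemeasurable (by fun_prop)
  have hs : AEStronglyMeasurable (fun x : EuclideanSpace ℝ (Fin d) => Real.exp (‖x‖ ^ 2 / 4))
      ((Measure.pi fun _ : Fin d => gaussianReal 0 1).map (WithLp.toLp 2)) :=
    Continuous.aestronglyMeasurable (by fun_prop)
  have hcomp : ∀ x : Fin d → ℝ, Real.exp (‖WithLp.toLp 2 x‖ ^ 2 / 4) =
      ∏ i, Real.exp (x i ^ 2 / 4) := by
    intro x
    rw [EuclideanSpace.real_norm_sq_eq, Finset.sum_div, Real.exp_sum]
  rw [← map_pi_eq_stdGaussian]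
  constructor
  · rw [integrable_map_measure hs hm]
    simp only [Function.comp_def, hcomp]
    exact Integrable.fintype_prod fun _ => integral_exp_sq_div_four_gaussianReal.1
  · rw [integral_map hm hs]
    simp_rw [hcomp]
    rw [integral_fintype_prod_eq_prod (f := fun _ x => Real.exp (x ^ 2 / 4))]
    simp [integral_exp_sq_div_four_gaussianReal.2]

/-- Markov's inequality for `exp (‖x‖ ^ 2 / 4)`, whose mean `√2 ^ d` is at most `exp d`; this is
absorbed by the term `d` under the root. -/
theorem stdGaussian_norm_gt_le (d : ℕ) {p : ℝ} (hp : 0 < p) (hp1 : p ≤ 1) :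
    stdGaussian (EuclideanSpace ℝ (Fin d)) {x | 2 * √(d + Real.log (1 / p)) < ‖x‖} ≤
      ENNReal.ofReal p := by
  obtain ⟨hint, hval⟩ := integral_exp_norm_sq_div_four_stdGaussian d
  have hlog : 0 ≤ Real.log (1 / p) := Real.log_nonneg (by rwa [one_le_div hp])
  set a := Real.exp (d + Real.log (1 / p)) with ha
  have hsub : {x : EuclideanSpace ℝ (Fin d) | 2 * √(d + Real.log (1 / p)) < ‖x‖} ⊆
      {x | a ≤ Real.exp (‖x‖ ^ 2 / 4)} := by
    intro x hx
    simp only [Set.mem_ofPred_eq] at hx ⊢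
    rw [ha, Real.exp_le_exp]
    have h1 : (2 * √(d + Real.log (1 / p))) ^ 2 ≤ ‖x‖ ^ 2 := by gcongr
    rw [mul_pow, Real.sq_sqrt (by positivity)] at h1
    linarith
  have hmk := mul_meas_ge_le_integral_of_nonneg
    (ae_of_all _ fun x : EuclideanSpace ℝ (Fin d) => (Real.exp_pos (‖x‖ ^ 2 / 4)).le) hint a
  rw [hval] at hmk
  refine (measure_mono hsub).trans ?_
  rw [← ofReal_measureReal]
  apply ENNReal.ofReal_le_ofReal
  have hapos : 0 < a := Real.exp_pos _
  refine le_of_mul_le_mul_left (hmk.trans ?_) hapos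
  rw [ha, Real.exp_add, Real.exp_log (by positivity)]
  have h2 : √2 ≤ Real.exp 1 := by
    have := Real.add_one_le_exp (1 : ℝ)
    have h3 : √2 ≤ 2 := Real.sqrt_le_iff.2 (by norm_num)
    linarith
  calc √2 ^ d ≤ Real.exp 1 ^ d := by gcongr
    _ = Real.exp d := by rw [← Real.exp_nat_mul, mul_one]
    _ = _ := by field_simp

end DPGIBO

namespace DPGIBO

/-! ### Orthogonal projection onto the span of finitely many vectors -/

section Projection

variable {H : Type*} [NormedAddCommGroup H] [InnerProductSpace ℝ H]
  {ι : Type*} [Fintype ι] [DecidableEq ι]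

/-- The combination of the vectors `v i` with coefficients `K⁻¹ b`, where `b i = ⟪v i, g⟫`. If `K`
is the Gram matrix of `v` and is invertible, it is the orthogonal projection of `g`. -/
noncomputable def gramProj (K : Matrix ι ι ℝ) (v : ι → H) (g : H) : H :=
  ∑ i, (K⁻¹ *ᵥ fun j => inner ℝ (v j) g) i • v i

theorem inner_sub_gramProj {K : Matrix ι ι ℝ} (hK : K.PosDef) {v : ι → H}
    (hv : ∀ i j, K i j = inner ℝ (v i) (v j)) (g : H) (i : ι) :
    inner ℝ (v i) (g - gramProj K v g) = 0 := by
  have hdet : IsUnit K.det := (Matrix.isUnit_iff_isUnit_det K).1 hK.isUnit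
  have h1 : inner ℝ (v i) (gramProj K v g) =
      (K *ᵥ (K⁻¹ *ᵥ fun j => inner ℝ (v j) g)) i := by
    rw [gramProj, inner_sum]
    conv_rhs => rw [Matrix.mulVec, dotProduct]
    exact Finset.sum_congr rfl fun j _ => by rw [inner_smul_right, hv, mul_comm]
  rw [inner_sub_right, h1, Matrix.mulVec_mulVec, Matrix.mul_nonsing_inv _ hdet,
    Matrix.one_mulVec, sub_self]

theorem inner_gramProj (K : Matrix ι ι ℝ) (v : ι → H) (g h : H) :
    inner ℝ (gramProj K v g) h =
      (fun i => inner ℝ (v i) h) ⬝ᵥ (K⁻¹ *ᵥ fun j => inner ℝ (v j) g) := by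
  rw [gramProj, sum_inner, dotProduct]
  exact Finset.sum_congr rfl fun i _ => by
    rw [inner_smul_left, mul_comm, RCLike.conj_to_real]

/-- Self-adjointness of the projection puts the weights `K⁻¹` on the data of `h`, the form in which
`postGrad` is defined. -/
theorem inner_gramProj_symm {K : Matrix ι ι ℝ} (hK : K.PosDef) (v : ι → H) (g h : H) :
    inner ℝ (gramProj K v g) h =
      ∑ i, (K⁻¹ *ᵥ fun j => inner ℝ (v j) h) i * inner ℝ (v i) g := by
  have hT : (K⁻¹)ᵀ = K⁻¹ := by
    have := hK.isHermitian.inv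
    rwa [Matrix.IsHermitian, Matrix.conjTranspose_eq_transpose_of_trivial] at this
  rw [inner_gramProj, Matrix.dotProduct_mulVec, ← Matrix.mulVec_transpose, hT]
  rfl

theorem norm_sub_gramProj_sq {K : Matrix ι ι ℝ} (hK : K.PosDef) {v : ι → H}
    (hv : ∀ i j, K i j = inner ℝ (v i) (v j)) (g : H) :
    ‖g - gramProj K v g‖ ^ 2 = ‖g‖ ^ 2 -
      (fun i => inner ℝ (v i) g) ⬝ᵥ (K⁻¹ *ᵥ fun j => inner ℝ (v j) g) := by
  have h1 : inner ℝ (gramProj K v g) (g - gramProj K v g) = 0 := by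
    conv_lhs => rw [gramProj, sum_inner]
    exact Finset.sum_eq_zero fun i _ => by
      rw [inner_smul_left, ← gramProj, inner_sub_gramProj hK hv, mul_zero]
  rw [← inner_gramProj, ← real_inner_self_eq_norm_sq, inner_sub_left, h1, sub_zero,
    inner_sub_right, real_inner_self_eq_norm_sq, real_inner_comm]

theorem norm_sub_gramProj_le {K : Matrix ι ι ℝ} (hK : K.PosDef) {v : ι → H}
    (hv : ∀ i j, K i j = inner ℝ (v i) (v j)) (g : H) {y : H}
    (hy : y ∈ Submodule.span ℝ (Set.range v)) :
    ‖g - gramProj K v g‖ ≤ ‖g - y‖ := by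
  have hperp : ∀ z ∈ Submodule.span ℝ (Set.range v), inner ℝ z (g - gramProj K v g) = 0 := by
    intro z hz
    induction hz using Submodule.span_induction with
    | mem z hz => obtain ⟨i, rfl⟩ := hz; exact inner_sub_gramProj hK hv g i
    | zero => exact inner_zero_left _
    | add a b _ _ ha hb => rw [inner_add_left, ha, hb, add_zero]
    | smul a z _ hz => rw [inner_smul_left, hz, mul_zero]
  have hm : gramProj K v g ∈ Submodule.span ℝ (Set.range v) :=
    Submodule.sum_mem _ fun i _ => Submodule.smul_mem _ _ (Submodule.subset_span ⟨i, rfl⟩)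
  have h1 := norm_add_sq_real (gramProj K v g - y) (g - gramProj K v g)
  rw [hperp _ (Submodule.sub_mem _ hm hy), show gramProj K v g - y + (g - gramProj K v g) = g - y
    by abel] at h1
  refine abs_le_of_sq_le_sq' ?_ (norm_nonneg _) |>.2
  nlinarith [sq_nonneg ‖gramProj K v g - y‖]

end Projection

/-! ### Differentiating a feature map -/

/-- Expanding `‖G n - G m‖ ^ 2` gives the limit `κ - 2 * κ + κ = 0`. -/
theorem cauchySeq_of_tendsto_inner {H : Type*} [NormedAddCommGroup H] [InnerProductSpace ℝ H]
    {G : ℕ → H} {κ : ℝ}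
    (h : Tendsto (fun p : ℕ × ℕ => inner ℝ (G p.1) (G p.2)) (atTop ×ˢ atTop) (𝓝 κ)) :
    CauchySeq G := by
  have hdiag : Tendsto (fun n => inner ℝ (G n) (G n)) atTop (𝓝 κ) :=
    h.comp (tendsto_id.prodMk tendsto_id)
  have hsq : Tendsto (fun p : ℕ × ℕ => ‖G p.1 - G p.2‖ ^ 2) (atTop ×ˢ atTop) (𝓝 0) := by
    have h1 := ((hdiag.comp tendsto_fst).sub (h.const_mul 2)).add
      (hdiag.comp (tendsto_snd (f := (atTop : Filter ℕ)) (g := (atTop : Filter ℕ))))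
    rw [show κ - 2 * κ + κ = 0 by ring] at h1
    refine h1.congr fun p => ?_
    simp only [Function.comp_apply]
    rw [norm_sub_sq_real, real_inner_self_eq_norm_sq, real_inner_self_eq_norm_sq]
  have hnorm : Tendsto (fun p : ℕ × ℕ => ‖G p.1 - G p.2‖) (atTop ×ˢ atTop) (𝓝 0) := by
    have := (Real.continuous_sqrt.tendsto 0).comp hsq
    rw [Real.sqrt_zero] at this
    exact this.congr fun p => Real.sqrt_sq (norm_nonneg _)
  rw [cauchySeq_iff_tendsto_dist_atTop_0, ← prod_atTop_atTop_eq]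
  simpa only [dist_eq_norm] using hnorm

/-- A second difference of `φ` is the second derivative at an intermediate point. -/
theorem exists_second_difference_eq {E : Type*} [NormedAddCommGroup E] [NormedSpace ℝ E]
    {φ : E → ℝ} (hφ : ContDiff ℝ 2 φ) (x e : E) {α β : ℝ} (hα : 0 < α) (hβ : 0 < β) :
    ∃ ξ : ℝ, |ξ| ≤ α + β ∧
      φ (x + (α - β) • e) - φ (x + (α + β) • e) - φ (x + (-α - β) • e) + φ (x + (-α + β) • e) =
        - (4 * α * β * fderiv ℝ (fun y => fderiv ℝ φ y e) (x + ξ • e) e) := by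
  have hd1 : Differentiable ℝ φ := hφ.differentiable (by norm_num)
  have hd2 : Differentiable ℝ fun y => fderiv ℝ φ y e :=
    ((hφ.fderiv_right (m := 1) (by norm_num)).clm_apply contDiff_const).differentiable
      (by norm_num)
  have hline : ∀ s : ℝ, HasDerivAt (fun s : ℝ => x + s • e) e s := fun s => by
    simpa using ((hasDerivAt_id s).smul_const e).const_add x
  have hφs : ∀ s : ℝ, HasDerivAt (fun s : ℝ => φ (x + s • e)) (fderiv ℝ φ (x + s • e) e) s :=
    fun s => (hd1 _).hasFDerivAt.comp_hasDerivAt s (hline s)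
  have hφs' : ∀ s : ℝ, HasDerivAt (fun s : ℝ => fderiv ℝ φ (x + s • e) e)
      (fderiv ℝ (fun y => fderiv ℝ φ y e) (x + s • e) e) s :=
    fun s => (hd2 _).hasFDerivAt.comp_hasDerivAt (f := fun s : ℝ => x + s • e) s (hline s)
  have hA : ∀ s : ℝ, HasDerivAt (fun s : ℝ => φ (x + (s - β) • e) - φ (x + (s + β) • e))
      (fderiv ℝ φ (x + (s - β) • e) e - fderiv ℝ φ (x + (s + β) • e) e) s := fun s =>
    ((hφs (s - β)).comp_sub_const s β).sub ((hφs (s + β)).comp_add_const s β)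
  -- The mean value theorem is applied first to the difference in `hA`, then to the directional
  -- derivative on `[s - β, s + β]`.
  obtain ⟨s, hs, hs'⟩ := exists_hasDerivAt_eq_slope _ _ (show -α < α by linarith)
    (fun s _ => (hA s).continuousAt.continuousWithinAt) (fun s _ => hA s)
  obtain ⟨ξ, hξ, hξ'⟩ := exists_hasDerivAt_eq_slope _ _ (show s - β < s + β by linarith)
    (fun s _ => (hφs' s).continuousAt.continuousWithinAt) (fun s _ => hφs' s)
  refine ⟨ξ, abs_le.2 ⟨by linarith [hs.1, hξ.1], by linarith [hs.2, hξ.2]⟩, ?_⟩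
  rw [eq_div_iff (by linarith)] at hs' hξ'
  linear_combination -hs' + 2 * α * hξ'

section Feature

variable {d : ℕ} {H : Type*} [NormedAddCommGroup H] [InnerProductSpace ℝ H]

/-- When `θ` is on the boundary of the ball, `θ ± h • e` may leave it. Moving from `θ` towards `c ±
r • e` stays inside by convexity, and the two points still differ by a multiple of `e`. -/
theorem add_smul_mem_closedBall {E : Type*} [NormedAddCommGroup E] [NormedSpace ℝ E]
    {c θ e : E} {r h σ : ℝ} (hr : 0 ≤ r) (hθ : θ ∈ Metric.closedBall c r) (he : ‖e‖ = 1)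
    (hσ : |σ| = 1) (h0 : 0 ≤ h) (h1 : h ≤ 1) :
    θ + h • (c - θ + (σ * r) • e) ∈ Metric.closedBall c r := by
  have h2 : c + (σ * r) • e ∈ Metric.closedBall c r := by
    rw [mem_closedBall_iff_norm, add_sub_cancel_left, norm_smul, he, mul_one, Real.norm_eq_abs,
      abs_mul, hσ, one_mul, abs_of_nonneg hr]
  have := (convex_closedBall c r).add_smul_sub_mem hθ h2 ⟨h0, h1⟩
  rwa [show c + (σ * r) • e - θ = c - θ + (σ * r) • e by abel] at this

theorem tendsto_difference_quotient {E : Type*} [NormedAddCommGroup E] [NormedSpace ℝ E]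
    {F : E → ℝ} {θ : E} (hF : DifferentiableAt ℝ F θ) (a e : E) {r : ℝ} (hr : 0 < r) {h : ℕ → ℝ}
    (h0 : ∀ n, 0 < h n) (hh : Tendsto h atTop (𝓝 0)) :
    Tendsto (fun n => (1 / (2 * r * h n)) * (F (θ + h n • (a + (1 * r) • e)) -
      F (θ + h n • (a + (-1 * r) • e)))) atTop (𝓝 (fderiv ℝ F θ e)) := by
  have hlim : ∀ u : E, Tendsto (fun n => (h n)⁻¹ * (F (θ + h n • u) - F θ)) atTop
      (𝓝 (fderiv ℝ F θ u)) := by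
    intro u
    have hl : HasDerivAt (fun t : ℝ => F (θ + t • u)) (fderiv ℝ F θ u) 0 :=
      hF.hasFDerivAt.hasLineDerivAt u
    have h1 := hl.tendsto_slope_zero
    have h2 : Tendsto h atTop (𝓝[≠] 0) :=
      tendsto_nhdsWithin_iff.2 ⟨hh, Eventually.of_forall fun n => (h0 n).ne'⟩
    refine (h1.comp h2).congr fun n => ?_
    simp
  have h3 := ((hlim (a + (1 * r) • e)).sub (hlim (a + (-1 * r) • e))).const_mul (1 / (2 * r))
  -- The common drift `a` cancels by linearity.
  have h4 : 1 / (2 * r) * (fderiv ℝ F θ (a + (1 * r) • e) - fderiv ℝ F θ (a + (-1 * r) • e)) =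
      fderiv ℝ F θ e := by
    simp only [map_add, map_smul, smul_eq_mul]
    field_simp
    ring
  rw [h4] at h3
  refine h3.congr fun n => ?_
  have := (h0 n).ne'
  field_simp
  ring

variable [CompleteSpace H]

/-- The derivative in the direction `e` of a feature map of a stationary kernel, at a point of a
closed ball inside the domain, exists as a limit of difference quotients taken in the ball. -/
theorem exists_feature_deriv {Θ : Set (Param d)} {k : Param d → Param d → ℝ} {Φ : Param d → H}
    (hΦ : ∀ p ∈ Θ, ∀ q ∈ Θ, inner ℝ (Φ p) (Φ q) = k p q) {φ : Param d → ℝ}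
    (hφ : ContDiff ℝ 2 φ) (hk : ∀ u v, k u v = φ (u - v)) {c θ e : Param d} {r : ℝ} (hr : 0 < r)
    (hsub : Metric.closedBall c r ⊆ Θ) (hθ : θ ∈ Metric.closedBall c r) (he : ‖e‖ = 1) :
    ∃ g : H, (∀ (h : H) (F : Param d → ℝ), (∀ p ∈ Θ, inner ℝ (Φ p) h = F p) →
        DifferentiableAt ℝ F θ → inner ℝ g h = fderiv ℝ F θ e) ∧
      ‖g‖ ^ 2 = - fderiv ℝ (fun y => fderiv ℝ φ y e) 0 e ∧
      ∀ ε > 0, ∃ p ∈ Θ, ∃ q ∈ Θ, ∃ s : ℝ, ‖g - s • (Φ p - Φ q)‖ < ε := by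
  obtain ⟨h, h0, h1, hh⟩ : ∃ h : ℕ → ℝ, (∀ n, 0 < h n) ∧ (∀ n, h n ≤ 1) ∧
      Tendsto h atTop (𝓝 0) := by
    refine ⟨fun n => 1 / ((n : ℝ) + 1), fun n => by positivity, fun n => ?_,
      tendsto_one_div_add_atTop_nhds_zero_nat⟩
    rw [div_le_one (by positivity)]
    linarith [Nat.cast_nonneg (α := ℝ) n]
  set p : ℕ → Param d := fun n => θ + h n • (c - θ + (1 * r) • e) with hp
  set q : ℕ → Param d := fun n => θ + h n • (c - θ + (-1 * r) • e) with hq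
  have hpΘ : ∀ n, p n ∈ Θ := fun n =>
    hsub (add_smul_mem_closedBall hr.le hθ he (by simp) (h0 n).le (h1 n))
  have hqΘ : ∀ n, q n ∈ Θ := fun n =>
    hsub (add_smul_mem_closedBall hr.le hθ he (by simp) (h0 n).le (h1 n))
  set G : ℕ → H := fun n => (1 / (2 * r * h n)) • (Φ (p n) - Φ (q n)) with hG
  set D2 : Param d → ℝ := fun x => fderiv ℝ (fun y => fderiv ℝ φ y e) x e with hD2
  have hD2c : Continuous D2 :=
    (((hφ.fderiv_right (m := 1) (by norm_num)).clm_apply contDiff_const).continuous_fderiv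
      (by norm_num)).clm_apply continuous_const
  -- By stationarity the inner product of two difference quotients is a normalized second difference
  -- of `φ` near `0`; continuity of `D2` makes it converge, so `G` is Cauchy.
  have hinner : ∀ n m, ∃ y : Param d, ‖y‖ ≤ (h n + h m) * (‖c - θ‖ + r) ∧
      inner ℝ (G n) (G m) = - D2 y := by
    intro n m
    obtain ⟨ξ, hξ, hval⟩ := exists_second_difference_eq hφ ((h n - h m) • (c - θ)) e
      (mul_pos (h0 n) hr) (mul_pos (h0 m) hr)
    refine ⟨(h n - h m) • (c - θ) + ξ • e, ?_, ?_⟩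
    · have hx : ‖(h n - h m) • (c - θ)‖ ≤ (h n + h m) * ‖c - θ‖ := by
        rw [norm_smul, Real.norm_eq_abs]
        gcongr
        exact abs_le.2 ⟨by linarith [h0 n, h0 m], by linarith [h0 n, h0 m]⟩
      calc _ ≤ _ := norm_add_le _ _
        _ ≤ (h n + h m) * ‖c - θ‖ + (h n * r + h m * r) := by
          rw [norm_smul ξ, he, mul_one]
          exact add_le_add hx hξ
        _ = _ := by ring
    · have e1 : p n - p m = (h n - h m) • (c - θ) + (h n * r - h m * r) • e := by
        simp only [hp]; module
      have e2 : p n - q m = (h n - h m) • (c - θ) + (h n * r + h m * r) • e := by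
        simp only [hp, hq]; module
      have e3 : q n - p m = (h n - h m) • (c - θ) + (-(h n * r) - h m * r) • e := by
        simp only [hp, hq]; module
      have e4 : q n - q m = (h n - h m) • (c - θ) + (-(h n * r) + h m * r) • e := by
        simp only [hq]; module
      simp only [hG, inner_smul_left, inner_smul_right, inner_sub_left, inner_sub_right,
        hΦ _ (hpΘ _) _ (hpΘ _), hΦ _ (hpΘ _) _ (hqΘ _), hΦ _ (hqΘ _) _ (hpΘ _),
        hΦ _ (hqΘ _) _ (hqΘ _), hk, RCLike.conj_to_real]
      rw [e1, e2, e3, e4]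
      have hn := (h0 n).ne'
      have hm := (h0 m).ne'
      have hr' := hr.ne'
      set x := (h n - h m) • (c - θ)
      have hval' : D2 (x + ξ • e) = -(φ (x + (h n * r - h m * r) • e) -
          φ (x + (h n * r + h m * r) • e) - φ (x + (-(h n * r) - h m * r) • e) +
          φ (x + (-(h n * r) + h m * r) • e)) / (4 * (h n * r) * (h m * r)) := by
        rw [hval]
        field_simp
        rfl
      rw [hval']
      field_simp
      ring
  choose y hy hyval using hinner
  have hy0 : Tendsto (fun x : ℕ × ℕ => y x.1 x.2) (atTop ×ˢ atTop) (𝓝 0) := by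
    refine squeeze_zero_norm (fun x => hy x.1 x.2) ?_
    have := ((hh.comp tendsto_fst).add
      (hh.comp (tendsto_snd (f := (atTop : Filter ℕ)) (g := (atTop : Filter ℕ))))).mul_const
        (‖c - θ‖ + r)
    simpa using this
  have hlim : Tendsto (fun x : ℕ × ℕ => inner ℝ (G x.1) (G x.2)) (atTop ×ˢ atTop)
      (𝓝 (- D2 0)) := by
    simp only [hyval]
    exact ((hD2c.tendsto 0).comp hy0).neg
  obtain ⟨g, hg⟩ := cauchySeq_tendsto_of_complete (cauchySeq_of_tendsto_inner hlim)
  refine ⟨g, ?_, ?_, ?_⟩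
  · intro f F hF hFd
    refine tendsto_nhds_unique (hg.inner tendsto_const_nhds)
      ((tendsto_difference_quotient hFd (c - θ) e hr h0 hh).congr fun n => ?_)
    simp only [hG, inner_smul_left, inner_sub_left, RCLike.conj_to_real]
    rw [hF _ (hpΘ n), hF _ (hqΘ n)]
  · rw [← real_inner_self_eq_norm_sq]
    have hdiag : Tendsto (fun n => inner ℝ (G n) (G n)) atTop (𝓝 (- D2 0)) :=
      hlim.comp (tendsto_id.prodMk tendsto_id)
    exact tendsto_nhds_unique (hg.inner hg) hdiag
  · intro ε hε
    obtain ⟨n, hn⟩ := ((Metric.tendsto_nhds.1 hg) ε hε).exists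
    refine ⟨p n, hpΘ n, q n, hqΘ n, 1 / (2 * r * h n), ?_⟩
    rwa [dist_comm, dist_eq_norm] at hn

end Feature

end DPGIBO

namespace DPGIBO

/-! ### Gradient uncertainty as a distance in the reproducing kernel Hilbert space -/

section Uncertainty

variable {d : ℕ} {H : Type*} [NormedAddCommGroup H] [InnerProductSpace ℝ H]

theorem hasLineDerivAt_dotProduct_left {E : Type*} [NormedAddCommGroup E] [NormedSpace ℝ E]
    {ι : Type*} [Fintype ι] {f : E → ι → ℝ} {f' : ι → ℝ} {x e : E} (a : ι → ℝ)
    (hf : ∀ i, HasLineDerivAt ℝ (fun y => f y i) (f' i) x e) :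
    HasLineDerivAt ℝ (fun y => f y ⬝ᵥ a) (f' ⬝ᵥ a) x e :=
  HasDerivAt.fun_sum fun i _ => HasDerivAt.mul_const (hf i) (a i)

theorem hasLineDerivAt_dotProduct_mulVec {E : Type*} [NormedAddCommGroup E] [NormedSpace ℝ E]
    {ι : Type*} [Fintype ι] {f : E → ι → ℝ} {f' : ι → ℝ} {x e : E} (a : ι → ℝ)
    (K : Matrix ι ι ℝ) (hf : ∀ i, HasLineDerivAt ℝ (fun y => f y i) (f' i) x e) :
    HasLineDerivAt ℝ (fun y => a ⬝ᵥ (K *ᵥ f y)) (a ⬝ᵥ (K *ᵥ f')) x e := by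
  simp only [Matrix.dotProduct_mulVec, dotProduct_comm (a ᵥ* K)]
  exact hasLineDerivAt_dotProduct_left _ hf

open scoped Classical in
-- The mixed derivative of `φ (u - v)` on the diagonal is `‖g‖ ^ 2`, and differentiating `k u p` and
-- `k p v` gives the inner products of `g` with the features. What remains is the Pythagorean
-- formula `norm_sub_gramProj_sq`.
theorem lineDeriv_lineDeriv_postKernel {Θ : Set (Param d)} {k : Param d → Param d → ℝ}
    {Φ : Param d → H} (hΦ : ∀ p ∈ Θ, ∀ q ∈ Θ, inner ℝ (Φ p) (Φ q) = k p q) {φ : Param d → ℝ}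
    (hφ : ContDiff ℝ 2 φ) (hk : ∀ u v, k u v = φ (u - v)) {θ e : Param d} {g : H}
    (hg : ∀ (h : H) (F : Param d → ℝ), (∀ p ∈ Θ, inner ℝ (Φ p) h = F p) →
      DifferentiableAt ℝ F θ → inner ℝ g h = fderiv ℝ F θ e)
    (hg2 : ‖g‖ ^ 2 = - fderiv ℝ (fun y => fderiv ℝ φ y e) 0 e)
    {D : Finset (Param d)} (hD : (D : Set (Param d)) ⊆ Θ) (hpos : (gram k D).PosDef) :
    lineDeriv ℝ (fun u => lineDeriv ℝ (fun v => postKernel k D u v) θ e) θ e =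
      ‖g - gramProj (gram k D) (fun p : D => Φ p) g‖ ^ 2 := by
  have hd1 : Differentiable ℝ φ := hφ.differentiable (by norm_num)
  have hd2 : Differentiable ℝ fun y => fderiv ℝ φ y e :=
    ((hφ.fderiv_right (m := 1) (by norm_num)).clm_apply contDiff_const).differentiable
      (by norm_num)
  have hleft : ∀ p : D, HasLineDerivAt ℝ (fun u => k u p) (inner ℝ (Φ p) g) θ e := by
    intro p
    have hdiff : DifferentiableAt ℝ (fun u => k u p) θ := by
      simp only [hk]; fun_prop
    rw [real_inner_comm, hg (Φ p) (fun u => k u p) (fun q hq => hΦ q hq p (hD p.2)) hdiff]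
    exact hdiff.hasFDerivAt.hasLineDerivAt e
  have hright : ∀ p : D, HasLineDerivAt ℝ (fun v => k p v) (inner ℝ (Φ p) g) θ e := by
    intro p
    have hdiff : DifferentiableAt ℝ (fun v => k p v) θ := by
      simp only [hk]; fun_prop
    rw [real_inner_comm, hg (Φ p) (fun v => k p v)
      (fun q hq => (real_inner_comm _ _).trans (hΦ p (hD p.2) q hq)) hdiff]
    exact hdiff.hasFDerivAt.hasLineDerivAt e
  have hkv : ∀ u, HasLineDerivAt ℝ (fun v => k u v) (- fderiv ℝ φ (u - θ) e) θ e := by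
    intro u
    simp only [hk]
    have h := (hd1 (u - θ)).hasFDerivAt.comp (f := fun v => u - v) θ
      ((hasFDerivAt_id θ).const_sub u)
    exact HasDerivAt.congr_deriv (h.hasLineDerivAt e) (by simp)
  have hinner : ∀ u, lineDeriv ℝ (fun v => postKernel k D u v) θ e =
      - fderiv ℝ φ (u - θ) e -
        (fun p : D => k u p) ⬝ᵥ ((gram k D)⁻¹ *ᵥ fun p : D => inner ℝ (Φ p) g) := by
    intro u
    refine HasLineDerivAt.lineDeriv ?_
    unfold postKernel
    exact HasDerivAt.sub (hkv u) (hasLineDerivAt_dotProduct_mulVec (fun p : D => k u p)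
      (gram k D)⁻¹ (f := fun v (p : D) => k p v) hright)
  simp only [hinner]
  refine HasLineDerivAt.lineDeriv ?_
  rw [norm_sub_gramProj_sq hpos (fun p q => (hΦ p (hD p.2) q (hD q.2)).symm), hg2]
  refine HasDerivAt.sub ?_ (hasLineDerivAt_dotProduct_left _ hleft)
  have h := ((hd2 (θ - θ)).hasFDerivAt.comp (f := fun u => u - θ) θ
    ((hasFDerivAt_id θ).sub_const θ)).hasLineDerivAt e
  rw [sub_self] at h
  exact HasDerivAt.neg h

theorem fderiv_single_eq_gradient_apply {F : Param d → ℝ} {θ : Param d} (i : Fin d) :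
    fderiv ℝ F θ (EuclideanSpace.single i 1) = gradient F θ i := by
  have h := EuclideanSpace.inner_single_right (𝕜 := ℝ) i 1 (gradient F θ)
  rw [inner_gradient_left] at h
  simpa using h

variable [CompleteSpace H]

open scoped Classical in
theorem exists_gradient_features {Θ : Set (Param d)} {k : Param d → Param d → ℝ}
    (hker : IsAdmissibleKernel Θ k) {Φ : Param d → H}
    (hΦ : ∀ p ∈ Θ, ∀ q ∈ Θ, inner ℝ (Φ p) (Φ q) = k p q) {c θ : Param d} {r : ℝ} (hr : 0 < r)
    (hsub : Metric.closedBall c r ⊆ Θ) (hθ : θ ∈ Metric.closedBall c r) :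
    ∃ g : Fin d → H,
      (∀ j (h : H) (F : Param d → ℝ), (∀ p ∈ Θ, inner ℝ (Φ p) h = F p) →
        DifferentiableAt ℝ F θ → inner ℝ (g j) h = gradient F θ j) ∧
      (∀ j, ∀ ε > 0, ∃ p ∈ Θ, ∃ q ∈ Θ, ∃ s : ℝ, ‖g j - s • (Φ p - Φ q)‖ < ε) ∧
      ∀ (D : Finset (Param d)), (D : Set (Param d)) ⊆ Θ →
        gradCovTrace k D θ = ∑ j, ‖g j - gramProj (gram k D) (fun p : D => Φ p) (g j)‖ ^ 2 := by
  obtain ⟨φ, hφ4, hk⟩ := hker.stationary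
  have hφ : ContDiff ℝ 2 φ := hφ4.of_le (by norm_num)
  choose g hg1 hg2 hg3 using fun j : Fin d =>
    exists_feature_deriv hΦ hφ hk (e := EuclideanSpace.single j (1 : ℝ)) hr hsub hθ (by simp)
  refine ⟨g, fun j h F hF hFd => ?_, hg3, fun D hD => ?_⟩
  · rw [hg1 j h F hF hFd, fderiv_single_eq_gradient_apply]
  · exact Finset.sum_congr rfl fun j _ =>
      lineDeriv_lineDeriv_postKernel hΦ hφ hk (hg1 j) (hg2 j) hD (hker.posDef D hD)

open scoped Classical in
/-- Difference quotients along the coordinate directions make the gradient uncertainty arbitrarily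
small with at most `2 d` evaluations. -/
theorem exists_isAdmissibleBatch {Θ : Set (Param d)} {k : Param d → Param d → ℝ}
    (hker : IsAdmissibleKernel Θ k) {Φ : Param d → H}
    (hΦ : ∀ p ∈ Θ, ∀ q ∈ Θ, inner ℝ (Φ p) (Φ q) = k p q) {c θ : Param d} {r : ℝ} (hr : 0 < r)
    (hsub : Metric.closedBall c r ⊆ Θ) (hθ : θ ∈ Metric.closedBall c r) (hd : 1 ≤ d)
    {ε : ℝ} (hε : 0 < ε) {D : Finset (Param d)} (hD : (D : Set (Param d)) ⊆ Θ) :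
    ∃ z, IsAdmissibleBatch k Θ ε D θ z ∧ z.card ≤ 2 * d := by
  obtain ⟨g, -, happ, htr⟩ := exists_gradient_features hker hΦ hr hsub hθ
  have hd0 : (0 : ℝ) < d := by exact_mod_cast hd
  -- The `d` squared errors, each at most `ε / d`, add up to `ε`. Earlier points in `D` only enlarge
  -- the span.
  choose p hp q hq s hs using fun j => happ j (√(ε / d)) (by positivity)
  have hzΘ : ((Finset.univ.image p ∪ Finset.univ.image q : Finset (Param d)) :
      Set (Param d)) ⊆ Θ := by
    intro x hx
    simp only [Finset.coe_union, Finset.coe_image, Finset.coe_univ, Set.image_univ] at hx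
    rcases hx with ⟨j, rfl⟩ | ⟨j, rfl⟩
    exacts [hp j, hq j]
  refine ⟨Finset.univ.image p ∪ Finset.univ.image q, ⟨hzΘ, ?_, ?_⟩, ?_⟩
  · exact Finset.card_pos.2 ⟨p ⟨0, hd⟩, Finset.mem_union_left _
      (Finset.mem_image_of_mem _ (Finset.mem_univ _))⟩
  · have hU : ((D ∪ (Finset.univ.image p ∪ Finset.univ.image q) : Finset (Param d)) :
        Set (Param d)) ⊆ Θ := by
      rw [Finset.coe_union]
      exact Set.union_subset hD hzΘ
    rw [htr _ hU]
    calc _ ≤ ∑ _j : Fin d, ε / d := by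
          refine Finset.sum_le_sum fun j _ => ?_
          have hle := norm_sub_gramProj_le (hker.posDef _ hU)
            (v := fun p : (D ∪ (Finset.univ.image p ∪ Finset.univ.image q) : Finset _) => Φ p)
            (fun p q => (hΦ p (hU p.2) q (hU q.2)).symm) (g j) (y := s j • (Φ (p j) - Φ (q j)))
            (Submodule.smul_mem _ _ (Submodule.sub_mem _
              (Submodule.subset_span ⟨⟨p j, by simp⟩, rfl⟩)
              (Submodule.subset_span ⟨⟨q j, by simp⟩, rfl⟩)))
          have h2 := pow_le_pow_left₀ (norm_nonneg _) (hle.trans (hs j).le) 2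
          rwa [Real.sq_sqrt (by positivity)] at h2
      _ = ε := by
          rw [Finset.sum_const, Finset.card_univ, Fintype.card_fin, nsmul_eq_mul]
          field_simp
  · refine (Finset.card_union_le _ _).trans ?_
    have h1 := Finset.card_image_le (s := Finset.univ) (f := p)
    have h2 := Finset.card_image_le (s := Finset.univ) (f := q)
    rw [Finset.card_univ, Fintype.card_fin] at h1 h2
    omega

open scoped Classical in
-- Each coordinate of the error is the inner product of `h` with the residual of `g j`, up to sign.
-- Cauchy–Schwarz and summation over `j` yield `‖h‖ ^ 2` times the trace.
theorem norm_postGrad_sub_gradient_le {Θ : Set (Param d)} {k : Param d → Param d → ℝ}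
    (hker : IsAdmissibleKernel Θ k) {Φ : Param d → H}
    (hΦ : ∀ p ∈ Θ, ∀ q ∈ Θ, inner ℝ (Φ p) (Φ q) = k p q) {c θ : Param d} {r : ℝ} (hr : 0 < r)
    (hsub : Metric.closedBall c r ⊆ Θ) (hθ : θ ∈ Metric.closedBall c r) {ε : ℝ}
    {D : Finset (Param d)} (hD : (D : Set (Param d)) ⊆ Θ) (hρ : gradCovTrace k D θ ≤ ε)
    {F : Param d → ℝ} {h : H} (hF : ∀ p ∈ Θ, inner ℝ (Φ p) h = F p)
    (hFd : DifferentiableAt ℝ F θ) {CX : ℝ} (hCX : ‖h‖ ≤ CX) :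
    ‖postGrad k D F θ - gradient F θ‖ ≤ CX * √ε := by
  obtain ⟨g, hg, -, htr⟩ := exists_gradient_features hker hΦ hr hsub hθ
  obtain ⟨φ, hφ, hk⟩ := hker.stationary
  have hcoord : ∀ j, (postGrad k D F θ - gradient F θ) j =
      - inner ℝ (g j - gramProj (gram k D) (fun p : D => Φ p) (g j)) h := by
    intro j
    rw [inner_sub_left, hg j h F hF hFd, inner_gramProj_symm (hker.posDef D hD), neg_sub]
    simp only [postGrad, PiLp.sub_apply, WithLp.ofLp_sum, Finset.sum_apply, PiLp.smul_apply,
      smul_eq_mul]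
    congr 1
    refine Finset.sum_congr rfl fun p _ => ?_
    have hdiff : DifferentiableAt ℝ (fun u => k u p) θ := by
      have hd1 : Differentiable ℝ φ := hφ.differentiable (by norm_num)
      simp only [hk]
      fun_prop
    rw [← hg j (Φ p) (fun u => k u p) (fun q hq => hΦ q hq p (hD p.2)) hdiff, real_inner_comm]
    congr 4
    ext q
    exact (hF q (hD q.2)).symm
  have hCX0 : 0 ≤ CX := (norm_nonneg h).trans hCX
  have hsq : ‖postGrad k D F θ - gradient F θ‖ ^ 2 ≤ CX ^ 2 * gradCovTrace k D θ := by
    rw [EuclideanSpace.real_norm_sq_eq, htr D hD, Finset.mul_sum]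
    refine Finset.sum_le_sum fun j _ => ?_
    rw [hcoord, neg_sq, ← sq_abs, ← mul_pow]
    gcongr
    calc _ ≤ _ := abs_real_inner_le_norm _ _
      _ ≤ _ := by rw [mul_comm]; gcongr
  rw [← Real.sqrt_sq hCX0, ← Real.sqrt_mul (by positivity)]
  exact Real.le_sqrt_of_sq_le (hsq.trans (by gcongr))

/-- Clipping moves `g` by at most `‖g‖ - B ≤ ‖g‖ - ‖v‖ ≤ ‖g - v‖` when it acts at all. -/
theorem norm_clip_sub_le {B : ℝ} {g v : Param d} (hv : ‖v‖ ≤ B) :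
    ‖clip B g - v‖ ≤ 2 * ‖g - v‖ := by
  have h1 : ‖clip B g - g‖ ≤ ‖g - v‖ := by
    rcases le_or_gt 1 (B / ‖g‖) with h | h
    · rw [clip, min_eq_left h, one_smul, sub_self, norm_zero]
      exact norm_nonneg _
    -- The zero vector falls into this case, because `B / 0 = 0`.
    · rcases eq_or_ne g 0 with rfl | hg
      · simp [clip]
      · have hg' : 0 < ‖g‖ := norm_pos_iff.2 hg
        rw [clip, min_eq_right h.le, show (B / ‖g‖) • g - g = -((1 - B / ‖g‖) • g) by module,
          norm_neg, norm_smul, Real.norm_of_nonneg (by linarith), sub_mul, one_mul,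
          div_mul_cancel₀ _ hg'.ne']
        have := norm_sub_norm_le g v
        linarith
  calc ‖clip B g - v‖ = ‖(clip B g - g) + (g - v)‖ := by congr 1; abel
    _ ≤ _ := norm_add_le _ _
    _ ≤ _ := by linarith

theorem hasGradientAt_avgLoss {𝒳 : Type*} {n : ℕ} {ℓ : Param d → 𝒳 → ℝ} {x : Fin n → 𝒳} {θ : Param d}
    (hd : ∀ i, DifferentiableAt ℝ (fun u => ℓ u (x i)) θ) :
    HasGradientAt (avgLoss ℓ x)
      ((1 / (n : ℝ)) • ∑ i, gradient (fun u => ℓ u (x i)) θ) θ := by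
  rw [hasGradientAt_iff_hasFDerivAt, map_smul, map_sum]
  exact (HasFDerivAt.fun_sum fun i _ => (hd i).hasGradientAt.hasFDerivAt).const_mul _

theorem norm_average_le {E : Type*} [NormedAddCommGroup E] [NormedSpace ℝ E] {n : ℕ} (hn : 0 < n)
    {v : Fin n → E} {b : ℝ} (hv : ∀ i, ‖v i‖ ≤ b) : ‖(1 / (n : ℝ)) • ∑ i, v i‖ ≤ b := by
  have hn' : (0 : ℝ) < n := by exact_mod_cast hn
  have h1 : ‖∑ i, v i‖ ≤ n * b := by
    refine (norm_sum_le _ _).trans ((Finset.sum_le_sum fun i _ => hv i).trans ?_)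
    simp
  rw [norm_smul, Real.norm_of_nonneg (by positivity), one_div, inv_mul_le_iff₀ hn']
  exact h1

theorem norm_approxGrad_sub_gradient_le {𝒳 : Type*} {n : ℕ} (hn : 0 < n) {B CX : ℝ}
    {Θ : Set (Param d)} {k : Param d → Param d → ℝ} {ℓ : Param d → 𝒳 → ℝ} {x : Fin n → 𝒳}
    (hker : IsAdmissibleKernel Θ k) {Φ : Param d → H}
    (hΦ : ∀ p ∈ Θ, ∀ q ∈ Θ, inner ℝ (Φ p) (Φ q) = k p q) {c θ : Param d} {r : ℝ} (hr : 0 < r)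
    (hsub : Metric.closedBall c r ⊆ Θ) (hθ : θ ∈ Metric.closedBall c r) {ε : ℝ}
    {D : Finset (Param d)} (hD : (D : Set (Param d)) ⊆ Θ) (hρ : gradCovTrace k D θ ≤ ε)
    (hℓ : HasBoundedGradients B Θ ℓ x)
    (hmem : ∀ i, ∃ h : H, (∀ p ∈ Θ, inner ℝ (Φ p) h = ℓ p (x i)) ∧ ‖h‖ ≤ CX) :
    ‖approxGrad k ℓ x B D θ - gradient (avgLoss ℓ x) θ‖ ≤ 2 * (CX * √ε) := by
  rw [(hasGradientAt_avgLoss fun i => (hℓ i θ (hsub hθ)).1).gradient, approxGrad, ← smul_sub,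
    ← Finset.sum_sub_distrib]
  refine norm_average_le hn fun i => ?_
  obtain ⟨h, hh, hCX⟩ := hmem i
  have h1 := norm_postGrad_sub_gradient_le hker hΦ hr hsub hθ hD hρ hh (hℓ i θ (hsub hθ)).1 hCX
  exact (norm_clip_sub_le (hℓ i θ (hsub hθ)).2).trans (by linarith)

end Uncertainty

end DPGIBO

namespace DPGIBO

/-! ### The iterates when the noise is bounded -/

section Iterates

variable {d : ℕ}

theorem gradient_eq_zero_of_isLocallyStronglyConvex {τ r : ℝ} (hr : 0 < r) {Θ : Set (Param d)}
    {f : Param d → ℝ} {θ₀ θs : Param d} (h : IsLocallyStronglyConvex τ r Θ f θ₀ θs) :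
    gradient f θs = 0 := by
  have hmin : IsLocalMin f θs := h.isLocalMinOn.isLocalMin
    (Filter.mem_of_superset (Metric.closedBall_mem_nhds θs hr) h.ball_subset)
  rw [gradient, hmin.fderiv_eq_zero, map_zero]

/-- The deterministic core: `a` bounds interpolation error and noise of one step together, and `a /
(1 - q)` is the fixed point of `u ↦ q * u + a`. -/
theorem iterates_of_noise_le {𝒳 H : Type*} [NormedAddCommGroup H] [InnerProductSpace ℝ H]
    [CompleteSpace H] {n T : ℕ} (hd : 1 ≤ d) (hn : 0 < n) {L τ r B η μ CX ε : ℝ} (hL : 0 < L)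
    (hτ : 0 < τ) (hr : 0 < r) (hB : 0 < B) (hη : 0 < η) (hηL : η ≤ 1 / L) (hμ : 0 < μ)
    (hε : 0 < ε) {Θ : Set (Param d)} {k : Param d → Param d → ℝ} {ℓ : Param d → 𝒳 → ℝ}
    {x : Fin n → 𝒳} {θ₀ θs : Param d} {Φ : Param d → H}
    (hΦ : ∀ p ∈ Θ, ∀ q ∈ Θ, inner ℝ (Φ p) (Φ q) = k p q)
    (hsmooth : IsSmoothOn L Θ (avgLoss ℓ x))
    (hconv : IsLocallyStronglyConvex τ r Θ (avgLoss ℓ x) θ₀ θs)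
    (hgrad : HasBoundedGradients B Θ ℓ x) (hker : IsAdmissibleKernel Θ k)
    (hmem : ∀ i, ∃ h : H, (∀ p ∈ Θ, inner ℝ (Φ p) h = ℓ p (x i)) ∧ ‖h‖ ≤ CX)
    {sel : Finset (Param d) → Param d → Finset (Param d)} (hsel : IsBatchRule k Θ ε sel)
    {w : ℕ → Param d} {W : ℝ} (hw : ∀ t < T, ‖w t‖ ≤ W) {q a : ℝ} (hq0 : 0 ≤ q) (hq1 : q < 1)
    (hqτ : 1 - η * τ ≤ q ^ 2)
    (ha : η * (2 * (CX * √ε) + 2 * B * √(T : ℝ) / (n * μ) * W) ≤ a) (har : a ≤ (1 - q) * r) :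
    let s := state k ℓ x sel B η μ T θ₀ w
    (∀ t ≤ T, (s t).2 ∈ Θ) ∧ (∀ t < T, ∃ z, IsAdmissibleBatch k Θ ε (s t).1 (s t).2 z) ∧
      (numEvals sel s T : ℝ) ≤ T * (2 * d) ∧
      avgLoss ℓ x (s T).2 - avgLoss ℓ x θs ≤ B * (q ^ T * r + a / (1 - q)) := by
  intro s
  have hsub := hconv.ball_subset
  have hq : 0 < 1 - q := by linarith
  have hdiff : ∀ θ ∈ Metric.closedBall θs r, DifferentiableAt ℝ (avgLoss ℓ x) θ := fun θ hθ =>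
    (hasGradientAt_avgLoss fun i => (hgrad i θ (hsub hθ)).1).differentiableAt
  have hc := gradient_eq_zero_of_isLocallyStronglyConvex hr hconv
  have hex : ∀ D θ, ((D : Finset (Param d)) : Set (Param d)) ⊆ Θ → θ ∈ Metric.closedBall θs r →
      ∃ z, IsAdmissibleBatch k Θ ε D θ z ∧ z.card ≤ 2 * d := fun D θ hD hθ =>
    exists_isAdmissibleBatch hker hΦ hr hsub hθ hd hε hD
  have hselp : ∀ D θ, ((D : Finset (Param d)) : Set (Param d)) ⊆ Θ →
      θ ∈ Metric.closedBall θs r →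
      IsAdmissibleBatch k Θ ε D θ (sel D θ) ∧ (sel D θ).card ≤ 2 * d := by
    intro D θ hD hθ
    obtain ⟨z, hz, hzc⟩ := hex D θ hD hθ
    obtain ⟨h1, h2⟩ := hsel D θ hD (hsub hθ) ⟨z, hz⟩
    exact ⟨h1, (h2 z hz).trans hzc⟩
  have hinv : ∀ t ≤ T, ((s t).1 : Set (Param d)) ⊆ Θ ∧ ‖(s t).2 - θs‖ ≤ r ∧
      ‖(s t).2 - θs‖ ≤ q ^ t * r + a / (1 - q) := by
    intro t
    induction t with
    | zero =>
      intro _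
      have hWa : ‖θ₀ - θs‖ ≤ r := hconv.init_close
      have ha0 : 0 ≤ a := by
        -- For `T = 0` the sign of `W` is unknown, but the factor `√T` removes that term.
        rcases Nat.eq_zero_or_pos T with hT | hT
        · subst hT
          obtain ⟨h, -, hh⟩ := hmem ⟨0, hn⟩
          have : 0 ≤ CX := (norm_nonneg h).trans hh
          refine le_trans ?_ ha
          simp only [CharP.cast_eq_zero, Real.sqrt_zero, mul_zero, zero_div, zero_mul, add_zero]
          positivity
        · obtain ⟨h, -, hh⟩ := hmem ⟨0, hn⟩
          have : 0 ≤ CX := (norm_nonneg h).trans hh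
          have : 0 ≤ W := (norm_nonneg _).trans (hw 0 hT)
          exact le_trans (by positivity) ha
      refine ⟨by simp [s, state], hWa, hWa.trans ?_⟩
      have : 0 ≤ a / (1 - q) := by positivity
      linarith [pow_zero q]
    | succ t ih =>
      intro ht
      obtain ⟨hD, hr1, hr2⟩ := ih (by omega)
      have hθ : (s t).2 ∈ Metric.closedBall θs r := by rwa [mem_closedBall_iff_norm]
      obtain ⟨⟨hz, -, hρ⟩, -⟩ := hselp _ _ hD hθ
      have hs1 : s (t + 1) = ((s t).1 ∪ sel (s t).1 (s t).2, (s t).2 -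
          η • (approxGrad k ℓ x B ((s t).1 ∪ sel (s t).1 (s t).2) (s t).2 +
            (2 * B * √(T : ℝ) / (n * μ)) • w t)) := rfl
      have hD' : (((s t).1 ∪ sel (s t).1 (s t).2 : Finset (Param d)) : Set (Param d)) ⊆ Θ := by
        rw [Finset.coe_union]
        exact Set.union_subset hD hz
      have happ := norm_approxGrad_sub_gradient_le hn hker hΦ hr hsub hθ hD' hρ hgrad hmem
      have hstep := norm_gradient_step_sub_sq_le hL hτ hη hηL hdiff
        (fun x hx y hy => hsmooth x (hsub hx) y (hsub hy)) hconv.strong hc hθ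
      have hstep' : ‖(s t).2 - η • gradient (avgLoss ℓ x) (s t).2 - θs‖ ≤
          q * ‖(s t).2 - θs‖ := by
        refine (abs_le_of_sq_le_sq' (hstep.trans ?_) (by positivity)).2
        rw [mul_pow]
        gcongr
      have hnoise : ‖(2 * B * √(T : ℝ) / (n * μ)) • w t‖ ≤ 2 * B * √(T : ℝ) / (n * μ) * W := by
        rw [norm_smul, Real.norm_of_nonneg (by positivity)]
        gcongr
        exact hw t (by omega)
      have hnext : ‖(s (t + 1)).2 - θs‖ ≤ q * ‖(s t).2 - θs‖ + a := by
        rw [hs1]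
        set D := (s t).1 ∪ sel (s t).1 (s t).2
        calc ‖(s t).2 - η • (approxGrad k ℓ x B D (s t).2 +
              (2 * B * √(T : ℝ) / (n * μ)) • w t) - θs‖
            = ‖((s t).2 - η • gradient (avgLoss ℓ x) (s t).2 - θs) -
                η • ((approxGrad k ℓ x B D (s t).2 - gradient (avgLoss ℓ x) (s t).2) +
                  (2 * B * √(T : ℝ) / (n * μ)) • w t)‖ := by congr 1; module
          _ ≤ q * ‖(s t).2 - θs‖ +
                η * (2 * (CX * √ε) + 2 * B * √(T : ℝ) / (n * μ) * W) := by
              refine (norm_sub_le _ _).trans (add_le_add hstep' ?_)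
              rw [norm_smul, Real.norm_of_nonneg hη.le]
              gcongr
              exact (norm_add_le _ _).trans (add_le_add happ hnoise)
          _ ≤ _ := by linarith
      refine ⟨by rw [hs1]; exact hD', ?_, ?_⟩
      · have := mul_le_mul_of_nonneg_left hr1 hq0
        linarith
      · have h1 := mul_le_mul_of_nonneg_left hr2 hq0
        have h2 : q * (a / (1 - q)) + a = a / (1 - q) := by field_simp; ring
        rw [pow_succ]
        linarith
  have hball : ∀ t ≤ T, (s t).2 ∈ Metric.closedBall θs r := fun t ht => by
    rw [mem_closedBall_iff_norm]; exact (hinv t ht).2.1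
  refine ⟨fun t ht => hsub (hball t ht), fun t ht => ?_, ?_, ?_⟩
  · exact ⟨_, (hselp _ _ (hinv t ht.le).1 (hball t ht.le)).1⟩
  · have : numEvals sel s T ≤ T * (2 * d) := by
      have h := Finset.sum_le_card_nsmul (Finset.range T) (fun t => (sel (s t).1 (s t).2).card)
        (2 * d) fun t ht => by
          have ht := (Finset.mem_range.1 ht).le
          exact (hselp _ _ (hinv t ht).1 (hball t ht)).2
      rwa [Finset.card_range, smul_eq_mul] at h
    exact_mod_cast this
  -- Convexity bounds the excess loss by `‖∇f‖` times the distance; the bound is linear in the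
  -- distance, which is all the stated rate needs.
  · have h1 := quadratic_le_of_strongly_monotone_gradient (convex_closedBall θs r) hdiff
      hconv.strong (hball T le_rfl) (Metric.mem_closedBall_self hr.le)
    have h2 : ‖gradient (avgLoss ℓ x) (s T).2‖ ≤ B := by
      rw [(hasGradientAt_avgLoss fun i => (hgrad i _ (hsub (hball T le_rfl))).1).gradient]
      exact norm_average_le hn fun i => (hgrad i _ (hsub (hball T le_rfl))).2
    have h3 := abs_real_inner_le_norm (gradient (avgLoss ℓ x) (s T).2) (θs - (s T).2)
    have h4 : ‖gradient (avgLoss ℓ x) (s T).2‖ * ‖θs - (s T).2‖ ≤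
        B * (q ^ T * r + a / (1 - q)) := by
      rw [norm_sub_rev]
      exact mul_le_mul h2 (hinv T le_rfl).2.2 (norm_nonneg _) hB.le
    have h5 : 0 ≤ τ / 2 * ‖θs - (s T).2‖ ^ 2 := by positivity
    linarith [neg_abs_le (inner ℝ (gradient (avgLoss ℓ x) (s T).2) (θs - (s T).2))]

theorem exists_feature_map {Θ : Set (Param d)} {k : Param d → Param d → ℝ} {H : Type*}
    [NormedAddCommGroup H] [InnerProductSpace ℝ H] [CompleteSpace H] [RKHS ℝ H Θ ℝ]
    (hH : IsRKHSOf Θ k H) :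
    ∃ Φ : Param d → H, (∀ p ∈ Θ, ∀ q ∈ Θ, inner ℝ (Φ p) (Φ q) = k p q) ∧
      ∀ (h : H) (p : Θ), inner ℝ (Φ p) h = h p := by
  classical
  refine ⟨fun p => if hp : p ∈ Θ then RKHS.kerFun H (⟨p, hp⟩ : Θ) (1 : ℝ) else 0, ?_, ?_⟩
  · intro p hp q hq
    simp only [hp, hq, dif_pos, RKHS.kerFun_inner, RKHS.kerFun_apply]
    simp [hH ⟨p, hp⟩ ⟨q, hq⟩]
  · intro h p
    simp [RKHS.kerFun_inner]

end Iterates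

/-! ### Parameters -/

theorem measure_exists_norm_gt_le {d T : ℕ} {δ : ℝ} (hδ : 0 < δ) (hδ1 : δ < 1) (hT : 1 ≤ T)
    {Ω : Type*} [MeasurableSpace Ω] {P : Measure Ω} {w : ℕ → Ω → Param d}
    (hw : ∀ t < T, HasLaw (w t) (stdGaussian (Param d)) P) :
    P {ω | ∃ t < T, 2 * √(d + Real.log (T / δ)) < ‖w t ω‖} ≤ ENNReal.ofReal δ := by
  have hT' : (1 : ℝ) ≤ T := by exact_mod_cast hT
  have hp : 0 < δ / T := by positivity
  have hp1 : δ / T ≤ 1 := by rw [div_le_one (by positivity)]; linarith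
  have hset : {ω | ∃ t < T, 2 * √(d + Real.log (T / δ)) < ‖w t ω‖} =
      ⋃ t ∈ Finset.range T, {ω | 2 * √(d + Real.log (T / δ)) < ‖w t ω‖} := by
    ext ω
    simp
  rw [hset]
  calc _ ≤ ∑ t ∈ Finset.range T, P {ω | 2 * √(d + Real.log (T / δ)) < ‖w t ω‖} :=
        measure_biUnion_finset_le _ _
    _ ≤ ∑ _t ∈ Finset.range T, ENNReal.ofReal (δ / T) := by
        refine Finset.sum_le_sum fun t ht => ?_
        rw [(hw t (Finset.mem_range.1 ht)).measure_eq
          (p := fun y => 2 * √(d + Real.log (T / δ)) < ‖y‖)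
          (measurableSet_lt measurable_const measurable_norm)]
        have := stdGaussian_norm_gt_le d hp hp1
        rwa [one_div_div] at this
    _ = ENNReal.ofReal δ := by
        rw [Finset.sum_const, Finset.card_range, nsmul_eq_mul, ← ENNReal.ofReal_natCast,
          ← ENNReal.ofReal_mul (by positivity)]
        congr 1
        field_simp

theorem exists_tolerance {τ r b CX : ℝ} (hτ : 0 < τ) (hr : 0 < r) (hb : 0 < b) (hCX : 0 ≤ CX) :
    ∃ ε₀ : ℝ, 0 < ε₀ ∧ 4 * CX ^ 2 * ε₀ ≤ τ ^ 2 * r ^ 2 ∧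
      ∀ ε, 0 < ε → ε ≤ ε₀ → 2 * (CX * √ε) ≤ b := by
  -- The tolerance is `(s / (2 * (CX + 1))) ^ 2`; the `+ 1` covers `CX = 0`.
  set s := min (τ * r) b with hs
  have hs0 : 0 < s := lt_min (by positivity) hb
  have hle : 2 * (CX * (s / (2 * (CX + 1)))) ≤ s := by
    have : 2 * (CX * (s / (2 * (CX + 1)))) = CX * s / (CX + 1) := by field_simp
    rw [this, div_le_iff₀ (by linarith)]
    nlinarith
  have h0 : 0 ≤ 2 * (CX * (s / (2 * (CX + 1)))) := by positivity
  refine ⟨(s / (2 * (CX + 1))) ^ 2, by positivity, ?_, fun ε _ hε => ?_⟩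
  · have h1 := pow_le_pow_left₀ h0 (hle.trans (min_le_left _ _)) 2
    linarith [show 4 * CX ^ 2 * (s / (2 * (CX + 1))) ^ 2 =
      (2 * (CX * (s / (2 * (CX + 1))))) ^ 2 by ring, mul_pow τ r 2]
  · have h1 : √ε ≤ s / (2 * (CX + 1)) := Real.sqrt_le_iff.2 ⟨by positivity, hε⟩
    calc 2 * (CX * √ε) ≤ 2 * (CX * (s / (2 * (CX + 1)))) := by gcongr
      _ ≤ b := hle.trans (min_le_right _ _)

theorem le_log_natCast_of_two_le {n : ℕ} (hn : 2 ≤ n) : 0.69 ≤ Real.log n := by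
  have h1 : Real.log 2 ≤ Real.log n := Real.log_le_log (by norm_num) (by exact_mod_cast hn)
  linarith [Real.log_two_gt_d9]

/-- For `n = 2` the number `log (log n)` is negative. The estimate `log l ≥ 1 - l⁻¹ ≥ -1 / 2` keeps
the rate bounded away from zero, so that additive constants can be absorbed. -/
theorem half_le_add_log_div {d : ℕ} (hd : 1 ≤ d) {l δ : ℝ} (hl : 0.69 ≤ l) (hδ : 0 < δ)
    (hδ1 : δ < 1) : 1 / 2 ≤ d + Real.log (l / δ) := by
  have hl0 : 0 < l := by linarith
  have hd' : (1 : ℝ) ≤ d := by exact_mod_cast hd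
  have h1 : Real.log l ≤ Real.log (l / δ) := by
    refine Real.log_le_log hl0 ?_
    rw [le_div_iff₀ hδ]
    nlinarith
  have h2 := Real.one_sub_inv_le_log_of_pos hl0
  have h3 : l⁻¹ ≤ 1.5 := by
    rw [inv_le_comm₀ hl0 (by norm_num)]
    norm_num
    linarith
  linarith

theorem ceil_mul_log_le {K : ℝ} (hK : 0 < K) {n : ℕ} (hn : 2 ≤ n) :
    (⌈K * Real.log n⌉₊ : ℝ) ≤ (K + 2) * Real.log n := by
  have hl := le_log_natCast_of_two_le hn
  have := Nat.ceil_lt_add_one (show 0 ≤ K * Real.log n by positivity)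
  linarith

theorem mul_add_log_le {d : ℕ} (hd : 1 ≤ d) {l δ K t : ℝ} (hl : 0.69 ≤ l) (hδ : 0 < δ)
    (hδ1 : δ < 1) (hK : 0 < K) (ht : 1 ≤ t) (htK : t ≤ K * l) :
    t * (d + Real.log (t / δ)) ≤ (K * (1 + 2 * K)) * (l * (d + Real.log (l / δ))) := by
  have hX := half_le_add_log_div hd hl hδ hδ1
  have hl0 : 0 < l := by linarith
  have h1 : Real.log (t / δ) ≤ K + Real.log (l / δ) := by
    calc Real.log (t / δ) ≤ Real.log (K * (l / δ)) := by
          refine Real.log_le_log (by positivity) ?_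
          rw [← mul_div_assoc]
          gcongr
      _ = Real.log K + Real.log (l / δ) := Real.log_mul hK.ne' (by positivity)
      _ ≤ _ := by linarith [Real.log_le_sub_one_of_pos hK]
  have h2 : d + Real.log (t / δ) ≤ (1 + 2 * K) * (d + Real.log (l / δ)) := by nlinarith
  calc t * (d + Real.log (t / δ)) ≤ (K * l) * ((1 + 2 * K) * (d + Real.log (l / δ))) := by
        refine mul_le_mul htK h2 ?_ (by positivity)
        have : 0 ≤ Real.log (t / δ) := Real.log_nonneg (by rw [le_div_iff₀ hδ]; linarith)
        positivity
    _ = _ := by ring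

end DPGIBO

/-! ### Choice of the constants and conclusion -/

theorem mainTheorem3
    (L τ r B η M : ℝ) (hL : 0 < L) (hτ : 0 < τ) (hr : 0 < r) (hB : 0 < B)
    (hη : 0 < η) (hηL : η ≤ 1 / L) (hM : 0 < M) :
    -- the constants depend only on `L, τ, r, B, η` and the upper bound `M` for `μ`
    ∃ K C₀ C : ℝ, 0 < K ∧ 0 < C₀ ∧ 0 < C ∧
      ∀ (d n T : ℕ) (δ μ CX : ℝ), 1 ≤ d → 2 ≤ n → 0 < δ → δ < 1 → 0 < μ → μ ≤ M → 0 ≤ CX →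
        T = ⌈K * Real.log n⌉₊ →
        C₀ * (√(T * (d + Real.log (T / δ))) / μ) ≤ n →
        -- the tolerance `ε` is chosen without access to the data, the losses or the kernel
        ∃ ε₀ : ℝ, 0 < ε₀ ∧ 4 * CX ^ 2 * ε₀ ≤ τ ^ 2 * r ^ 2 ∧
          ∀ (ε : ℝ), 0 < ε → ε ≤ ε₀ →
          ∀ (Θ : Set (DPGIBO.Param d)) (k : DPGIBO.Param d → DPGIBO.Param d → ℝ)
            (𝒳 : Type*) (ℓ : DPGIBO.Param d → 𝒳 → ℝ) (x : Fin n → 𝒳)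
            (θ₀ θs : DPGIBO.Param d)
            (H : Type*) [NormedAddCommGroup H] [InnerProductSpace ℝ H] [CompleteSpace H]
            [RKHS ℝ H Θ ℝ],
            IsCompact Θ →
            DPGIBO.IsSmoothOn L Θ (DPGIBO.avgLoss ℓ x) →
            DPGIBO.IsLocallyStronglyConvex τ r Θ (DPGIBO.avgLoss ℓ x) θ₀ θs →
            DPGIBO.HasBoundedGradients B Θ ℓ x →
            DPGIBO.IsAdmissibleKernel Θ k →
            DPGIBO.IsRKHSOf Θ k H →
            DPGIBO.HasBoundedRKHSNorm CX Θ ℓ x H →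
            ∀ (sel : Finset (DPGIBO.Param d) → DPGIBO.Param d → Finset (DPGIBO.Param d)),
              DPGIBO.IsBatchRule k Θ ε sel →
            ∀ (Ω : Type*) [MeasurableSpace Ω] (P : Measure Ω) [IsProbabilityMeasure P]
              (w : ℕ → Ω → DPGIBO.Param d),
              (∀ t < T, HasLaw (w t) (stdGaussian (DPGIBO.Param d)) P) →
              iIndepFun (fun t : Fin T => w t) P →
              -- the event inside the negation has probability at least `1 - δ`
              P {ω | ¬ (
                let s := DPGIBO.state k ℓ x sel B η μ T θ₀ (fun t => w t ω)
                (∀ t ≤ T, (s t).2 ∈ Θ) ∧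
                (∀ t < T, ∃ z, DPGIBO.IsAdmissibleBatch k Θ ε (s t).1 (s t).2 z) ∧
                (DPGIBO.numEvals sel s T : ℝ) ≤ C * (d * Real.log n) ∧
                DPGIBO.avgLoss ℓ x (s T).2 - DPGIBO.avgLoss ℓ x θs ≤
                  C * (√(Real.log n * (d + Real.log (Real.log n / δ))) / (n * μ)))}
                ≤ ENNReal.ofReal δ := by
  -- With this `q`, `1 - η * τ ≤ exp (-(η * τ)) = q ^ 2`, and `K = 2 / (η * τ)` gives `q ^ T ≤ 1 /
  -- n`.
  set q := Real.exp (-(η * τ / 2)) with hq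
  have hq1 : q < 1 := by rw [hq, Real.exp_lt_one_iff]; linarith [mul_pos hη hτ]
  have hc : 0 < 1 - q := by linarith
  have hqτ : 1 - η * τ ≤ q ^ 2 := by
    rw [hq, ← Real.exp_nat_mul]
    refine le_trans ?_ (Real.add_one_le_exp _)
    push_cast
    linarith
  set K := 2 / (η * τ) with hK
  have hK0 : 0 < K := by positivity
  set A := (K + 2) * (1 + 2 * (K + 2)) with hA
  refine ⟨K, 8 * B * η / ((1 - q) * r),
    2 * (K + 2) + B * ((r + η / (1 - q)) * (2 * M) + 4 * B * η / (1 - q) * √A), hK0, by positivity,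
    by positivity, ?_⟩
  intro d n T δ μ CX hd hn hδ hδ1 hμ hμM hCX hT hnC
  have hl := DPGIBO.le_log_natCast_of_two_le hn
  have hn0 : 0 < n := by omega
  have hnR : (0 : ℝ) < n := by exact_mod_cast hn0
  set l := Real.log n with hldef
  have hl0 : 0 < l := by linarith
  have hT1 : 1 ≤ T := by rw [hT]; exact Nat.ceil_pos.2 (by positivity)
  have hT1R : (1 : ℝ) ≤ T := by exact_mod_cast hT1
  have hTK : (T : ℝ) ≤ (K + 2) * l := by rw [hT]; exact DPGIBO.ceil_mul_log_le hK0 hn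
  have hX := DPGIBO.half_le_add_log_div hd hl hδ hδ1
  set S := √(l * (d + Real.log (l / δ))) / (n * μ) with hS
  set R := √(T * (d + Real.log (T / δ))) / (n * μ) with hR
  -- Noise takes half of the allowance `(1 - q) * r`; the tolerance leaves the other half to the
  -- interpolation error.
  have hRC : 4 * B * η * R ≤ (1 - q) * r / 2 := by
    have h1 : R = √(T * (d + Real.log (T / δ))) / μ / n := by rw [hR]; field_simp
    have h2 : 8 * B * η / ((1 - q) * r) * R ≤ 1 := by
      rw [h1, ← mul_div_assoc, div_le_one hnR]
      exact hnC
    rw [div_mul_eq_mul_div, div_le_one (by positivity)] at h2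
    linarith
  have hRS : R ≤ √A * S := by
    rw [hS, ← mul_div_assoc, ← Real.sqrt_mul (by positivity), hR]
    exact div_le_div_of_nonneg_right (Real.sqrt_le_sqrt
      (DPGIBO.mul_add_log_le hd hl hδ hδ1 (by positivity) hT1R hTK)) (by positivity)
  -- Terms of order `1 / n` are absorbed into the rate `S`; here the upper bound on `μ` enters.
  have hnS : 1 / (n : ℝ) ≤ 2 * M * S := by
    have h1 : 1 / 2 ≤ √(l * (d + Real.log (l / δ))) := by
      refine Real.le_sqrt_of_sq_le ?_
      nlinarith
    have h2 : 2 * M * S = 2 * √(l * (d + Real.log (l / δ))) * (M / μ) * (1 / n) := by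
      rw [hS]; field_simp
    have h3 : 1 ≤ M / μ := by rwa [one_le_div hμ]
    rw [h2]
    refine le_mul_of_one_le_left (by positivity) ?_
    nlinarith
  have hqT : q ^ T ≤ 1 / n := by
    rw [hq, ← Real.exp_nat_mul, one_div, ← Real.exp_log hnR, ← Real.exp_neg, Real.exp_le_exp,
      ← hldef]
    have h1 : K * l ≤ T := by rw [hT]; exact Nat.le_ceil _
    have h2 : K * l * (η * τ / 2) = l := by rw [hK]; field_simp
    have h3 := mul_le_mul_of_nonneg_right h1 (show 0 ≤ η * τ / 2 by positivity)
    linarith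
  -- The first bound keeps the iterates in the ball; the second makes the interpolation error
  -- negligible in the rate.
  obtain ⟨ε₀, hε₀, hεC, hβ⟩ := DPGIBO.exists_tolerance (b := min ((1 - q) * r / (2 * η)) (1 / n))
    hτ hr (lt_min (by positivity) (by positivity)) hCX
  refine ⟨ε₀, hε₀, hεC, ?_⟩
  intro ε hε hεε₀ Θ k 𝒳 ℓ x θ₀ θs H _ _ _ _ _ hsmooth hconv hgrad hker hH hmem sel hsel Ω _ P _ w
    hw _
  obtain ⟨Φ, hΦ, hΦh⟩ := DPGIBO.exists_feature_map hH
  have hmem' : ∀ i, ∃ h : H, (∀ p ∈ Θ, inner ℝ (Φ p) h = ℓ p (x i)) ∧ ‖h‖ ≤ CX := fun i => by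
    obtain ⟨h, h1, h2⟩ := hmem i
    exact ⟨h, fun p hp => (hΦh h ⟨p, hp⟩).trans (h1 ⟨p, hp⟩), h2⟩
  have hβ1 := (hβ ε hε hεε₀).trans (min_le_left _ _)
  have hβ2 := (hβ ε hε hεε₀).trans (min_le_right _ _)
  refine (measure_mono ?_).trans (DPGIBO.measure_exists_norm_gt_le hδ hδ1 hT1 hw)
  intro ω hω
  simp only [Set.mem_ofPred_eq] at hω ⊢
  by_contra hcon
  push Not at hcon
  apply hω
  have hσ : 2 * B * √(T : ℝ) / (n * μ) * (2 * √(d + Real.log (T / δ))) = 4 * B * R := by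
    rw [hR, Real.sqrt_mul (by positivity)]
    ring
  have har : η * (2 * (CX * √ε) + 4 * B * R) ≤ (1 - q) * r := by
    rw [le_div_iff₀ (by positivity)] at hβ1
    linarith
  obtain ⟨h1, h2, h3, h4⟩ := DPGIBO.iterates_of_noise_le hd hn0 hL hτ hr hB hη hηL hμ hε hΦ hsmooth
    hconv hgrad hker hmem' hsel hcon (Real.exp_pos _).le hq1 hqτ (by rw [hσ]) har
  have hCF : 0 ≤ B * ((r + η / (1 - q)) * (2 * M) + 4 * B * η / (1 - q) * √A) := by positivity
  refine ⟨h1, h2, h3.trans ?_, h4.trans ?_⟩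
  · calc (T : ℝ) * (2 * d) ≤ (K + 2) * l * (2 * d) := by gcongr
      _ = 2 * (K + 2) * (d * l) := by ring
      _ ≤ _ := by
          rw [add_mul]
          exact le_add_of_nonneg_right (mul_nonneg hCF (by positivity))
  · have hS0 : 0 ≤ S := by positivity
    calc B * (q ^ T * r + η * (2 * (CX * √ε) + 4 * B * R) / (1 - q))
        ≤ B * ((2 * M * S) * r + η * ((2 * M * S) + 4 * B * (√A * S)) / (1 - q)) := by
          exact mul_le_mul_of_nonneg_left (add_le_add
            (mul_le_mul_of_nonneg_right (hqT.trans hnS) hr.le) (div_le_div_of_nonneg_right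
              (mul_le_mul_of_nonneg_left (add_le_add (hβ2.trans hnS)
                (mul_le_mul_of_nonneg_left hRS (by positivity))) hη.le) hc.le)) hB.le
      _ = B * ((r + η / (1 - q)) * (2 * M) + 4 * B * η / (1 - q) * √A) * S := by
          field_simp
          ring
      _ ≤ _ := mul_le_mul_of_nonneg_right (le_add_of_nonneg_left (by positivity)) hS0
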